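/- Setting. Fix a nonnegative radial function $\chi\in C_0^\infty(B(0,1))$ on $\mathbb R^3$ with $\chi(\xi)=1$ for $|\xi|\le 1/2$, put $\phi(\xi)=\chi(\xi/2)-\chi(\xi)$, and fix an integer $M>1$ and a mollifier $\eta$ on $\mathbb R^3$ (smooth, nonnegative, supported in the unit ball, $\int\eta=1$). Let $L,T>0$, let $\mathbb T^3_L$ be the torus of side $L$ (represented by the periodic box $[0,L)^3$), $\Omega_T=[0,T]\times\mathbb T^3_L$, $\lambda_q=2^q/L$ and $\ell_q=\lambda_q^{-1}$. For a vector field $u\in L^2(\Omega_T;\mathbb R^3)$ and $q\ge 0$ let $$u_q(t,x)=\sum_{k\in\frac1L\mathbb Z^3}\phi(Lk/2^q)\,\hat u(t,k)\,e^{2\pi i k\cdot x},\qquad \hat u(t,k)=\frac1{L^3}\int_{\mathbb T^3_L}u(t,x)e^{-2\pi i k\cdot x}\,dx .$$ Let $\langle\cdot\rangle$ denote the average over $\Omega_T$, and put $$V_q=L^3\frac{\langle|u_q|^2\rangle^3}{\langle|u_q|^3\rangle^2},\qquad \mathfrak h=\liminf_{q\to\infty}\frac{\log_2(L^3/V_q)}{q}\in[0,\infty],\qquad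 d=3-\mathfrak h\in[-\infty,3].$$ For $k\in[0,2^q-1]^3\cap\mathbb Z^3$ let $Q_{qk}=[0,\ell_q)^3+\ell_q k$, and let $Q^*_{qk}$ be the union of the cubes $Q_{qk'}$ with $|k'-k|<3$, where indices are understood on the torus, that is, modulo $2^q$ in each coordinate. Let $\chi_{qk}$ be the periodic characteristic function of $Q_{qk}$, let $\eta_q(x)=2^{3q}\eta(\lambda_q x)$, let $$\chi'_{qk}(x)=\frac1{L^3}\int_{\mathbb R^3}\chi_{qk}(x-y)\,\eta_q(y)\,dy,\qquad b_{qk}=u_q\chi'_{qk},$$ and define the atomic coefficients $$s_{qk}(t)=\max_{|\beta|\le M}\lambda_q^{-|\beta|}\,\|\partial_x^\beta b_{qk}(t,\cdot)\|_{L^\infty}.$$ Let $(\sigma_q)_{q\ge0}$ be a decreasing sequence of positive numbers with $\sigma_q\to0$ and $\frac{\log\sigma_q}{q}\to0$. The active regions are $$A_q(t)=\bigcup_{k:\ s_{qk}(t)>\sigma_q\langle|u_q|^3\rangle/\langle|u_q|^2\rangle}Q^*_{qk},\qquad A_q=\{(t,x)\in\Omega_T: x\in A_q(t)\},$$ and the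 accumulant is $A=\limsup_{q\to\infty}A_q=\bigcap_{p\ge1}\bigcup_{q>p}A_q$, with time slices $A(t)=\{x:(t,x)\in A\}$. Quotients are taken in $[0,\infty]$ with $0/0=0$; thus $V_q=0$ if $u_q=0$ or $\langle|u_q|^3\rangle=\infty$. Theorem. There is a constant $c>0$, depending only on the fixed choices $\chi,\eta,M$ (and not on $L,T,(\sigma_q),u,q$), such that for all $L,T$, $(\sigma_q)$ and $u\in L^2(\Omega_T;\mathbb R^3)$ as above: 1. $|A_q|\le c\,\sigma_q^{-3}\,V_q\,T$ for every $q\ge0$; 2. for every $q\ge0$ with $\int_{\Omega_T}|u_q|^3\,dx\,dt<\infty$, $$(1-c\,\sigma_q)\int_{\Omega_T}|u_q|^3\,dx\,dt\ \le\ \int_{A_q}|u_q|^3\,dx\,dt\ \le\ \int_{\Omega_T}|u_q|^3\,dx\,dt;$$ 3. if $d\ge0$, then $\dim_{\mathcal H}A(t)\le d$ for a.e. $t\in[0,T]$; if $d<0$, then $A(t)=\emptyset$ for a.e. $t\in[0,T]$. -/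

import Mathlib

open MeasureTheory Filter Set
open scoped ENNReal Topology ContDiff

noncomputable section

namespace Intermittency

/-- Euclidean three-space. -/
abbrev E3 : Type := EuclideanSpace ℝ (Fin 3)

/-- Complex three-space, in which Fourier coefficients live. -/
abbrev C3 : Type := EuclideanSpace ℂ (Fin 3)

/-- The cut-offs from which the Littlewood-Paley decomposition is built: nonnegative, radial,
in `C₀^∞(B(0,1))` and equal to `1` for `|ξ| ≤ 1/2`. -/
structure IsCutoff (χ : E3 → ℝ) : Prop where
  smooth : ContDiff ℝ ∞ χ
  supp : tsupport χ ⊆ Metric.ball 0 1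
  compact : HasCompactSupport χ
  nonneg : ∀ ξ, 0 ≤ χ ξ
  radial : ∀ ξ ζ : E3, ‖ξ‖ = ‖ζ‖ → χ ξ = χ ζ
  eq_one : ∀ ξ : E3, ‖ξ‖ ≤ 1 / 2 → χ ξ = 1

/-- Approximative kernels: smooth, nonnegative, supported on the unit ball, of integral one. -/
structure IsMollifier (η : E3 → ℝ) : Prop where
  smooth : ContDiff ℝ ∞ η
  supp : tsupport η ⊆ Metric.closedBall 0 1
  nonneg : ∀ x, 0 ≤ η x
  integral_eq_one : ∫ x, η x = 1

/-- The periodic box `[0,L)^3`, the fundamental domain that represents the torus of side `L`.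
The identification preserves the measure, and it preserves the Hausdorff dimension of sets since
the flat metric of the torus and the Euclidean metric agree locally, on finitely many pieces. -/
def box (L : ℝ) : Set E3 := {x | ∀ i, 0 ≤ x i ∧ x i < L}

/-- The space-time domain `Ω_T = [0,T] × 𝕋³_L`. -/
def spaceTime (L T : ℝ) : Set (ℝ × E3) := Icc 0 T ×ˢ box L

/-- The dyadic wave number `λ_q = 2^q / L`. -/
def waveNumber (L : ℝ) (q : ℕ) : ℝ := 2 ^ q / L

/-- The dyadic length scale `ℓ_q = λ_q⁻¹ = L / 2^q`. -/
def lengthScale (L : ℝ) (q : ℕ) : ℝ := L / 2 ^ q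

/-- The point `m / L` of the lattice `(1/L) ℤ^3`. -/
def latticePoint (L : ℝ) (m : Fin 3 → ℤ) : E3 := WithLp.toLp 2 (fun i => (m i : ℝ) / L)

/-- The Littlewood-Paley multiplier `φ_q(ξ) = φ(L ξ / 2^q)`, `q ≥ 0`, where
`φ(ξ) = χ(ξ/2) - χ(ξ)`. -/
def multiplier (χ : E3 → ℝ) (L : ℝ) (q : ℕ) (ξ : E3) : ℝ :=
  χ ((2 : ℝ)⁻¹ • ((L / 2 ^ q) • ξ)) - χ ((L / 2 ^ q) • ξ)

/-- The Fourier coefficient `L⁻³ ∫ v(x) e^{-2πi k·x} dx` of a field `v` on the torus. -/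
def fourierCoeffBox (L : ℝ) (v : E3 → E3) (k : E3) : C3 :=
  WithLp.toLp 2 (fun i =>
    ((L ^ 3 : ℝ) : ℂ)⁻¹ *
      ∫ x in box L, Complex.exp (-(2 * Real.pi * (inner ℝ k x : ℝ) * Complex.I)) * (v x i : ℂ))

/-- The Littlewood-Paley piece `v_q = 𝓕⁻¹(φ_q 𝓕 v)`, as an `L`-periodic function on `ℝ³`.
Only finitely many terms are nonzero, and the values are real vectors since `φ_q` is even. -/
def piece (χ : E3 → ℝ) (L : ℝ) (v : E3 → E3) (q : ℕ) (x : E3) : C3 :=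
  ∑' m : Fin 3 → ℤ,
    ((multiplier χ L q (latticePoint L m) : ℂ) *
        Complex.exp (2 * Real.pi * (inner ℝ (latticePoint L m) x : ℝ) * Complex.I)) •
      fourierCoeffBox L v (latticePoint L m)

/-- The space-time average `⟨|u_q|^p⟩` over `Ω_T`, as an extended nonnegative number. -/
def meanPow (χ : E3 → ℝ) (L T : ℝ) (u : ℝ → E3 → E3) (q p : ℕ) : ℝ≥0∞ :=
  ⨍⁻ z in spaceTime L T, ‖piece χ L (u z.1) q z.2‖ₑ ^ p ∂volume

/-- The active volume `V_q = L³ ⟨|u_q|²⟩³ / ⟨|u_q|³⟩²`. It is `0` if `u_q = 0` (as `0 / 0 = 0`)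
and if `⟨|u_q|³⟩ = ∞`. -/
def activeVolume (χ : E3 → ℝ) (L T : ℝ) (u : ℝ → E3 → E3) (q : ℕ) : ℝ≥0∞ :=
  ENNReal.ofReal (L ^ 3) * (meanPow χ L T u q 2 ^ 3 / meanPow χ L T u q 3 ^ 2)

/-- The co-dimension `𝔥 = liminf log₂(L³ / V_q) / q`, an extended real number. -/
def codimension (χ : E3 → ℝ) (L T : ℝ) (u : ℝ → E3 → E3) : EReal :=
  liminf (fun q : ℕ =>
    ENNReal.log (ENNReal.ofReal (L ^ 3) / activeVolume χ L T u q) /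
      ((Real.log 2 : ℝ) : EReal) / ((q : ℝ) : EReal)) atTop

/-- The dimension `d = 3 - 𝔥`. -/
def dimension (χ : E3 → ℝ) (L T : ℝ) (u : ℝ → E3 → E3) : EReal :=
  3 - codimension χ L T u

/-- The dyadic cube `Q_{qk} = [0,ℓ_q)^3 + ℓ_q k`, `k ∈ [0, 2^q - 1]^3`. -/
def cube (L : ℝ) (q : ℕ) (k : Fin 3 → Fin (2 ^ q)) : Set E3 :=
  {x | ∀ i, lengthScale L q * ((k i : ℕ) : ℝ) ≤ x i ∧
    x i < lengthScale L q * (((k i : ℕ) : ℝ) + 1)}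

/-- `|k' - k| < 3` for two indices of cubes on the torus, i.e. modulo `2^q` in each coordinate. -/
def Near (q : ℕ) (k' k : Fin 3 → Fin (2 ^ q)) : Prop :=
  ∃ n : Fin 3 → ℤ, ∑ i, (((k' i : ℕ) : ℤ) - ((k i : ℕ) : ℤ) + 2 ^ q * n i) ^ 2 < 3 ^ 2

/-- The dilated cube `Q*_{qk}`, the union of the cubes `Q_{qk'}` with `|k' - k| < 3`. -/
def dilatedCube (L : ℝ) (q : ℕ) (k : Fin 3 → Fin (2 ^ q)) : Set E3 :=
  ⋃ (k' : Fin 3 → Fin (2 ^ q)) (_ : Near q k' k), cube L q k'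

/-- The `L`-periodic extension of `Q_{qk}` to `ℝ³`. -/
def periodicCube (L : ℝ) (q : ℕ) (k : Fin 3 → Fin (2 ^ q)) : Set E3 :=
  {x | ∃ n : Fin 3 → ℤ, x + WithLp.toLp 2 (fun i => L * (n i : ℝ)) ∈ cube L q k}

/-- The mollified characteristic function `χ'_{qk} = χ_{qk} ⋆ η_q` with
`η_q(x) = 2^{3q} η(λ_q x)`; convolution is with respect to the normalized measure `L⁻³ dx`, and
for the periodic `χ_{qk}` the integral over `ℝ³` is the convolution on the torus. -/
def smoothIndicator (η : E3 → ℝ) (L : ℝ) (q : ℕ) (k : Fin 3 → Fin (2 ^ q)) (x : E3) : ℝ :=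
  (L ^ 3)⁻¹ * ∫ y : E3,
    (periodicCube L q k).indicator (fun _ => (1 : ℝ)) (x - y) *
      (2 ^ (3 * q) * η (waveNumber L q • y))

/-- The localized piece `b_{qk} = u_q χ'_{qk}`. -/
def localPiece (χ η : E3 → ℝ) (L : ℝ) (v : E3 → E3) (q : ℕ) (k : Fin 3 → Fin (2 ^ q))
    (x : E3) : C3 :=
  smoothIndicator η L q k x • piece χ L v q x

/-- The atomic coefficient `s_{qk} = max_{|β| ≤ M} λ_q^{-|β|} ‖∂^β b_{qk}‖_∞`. A partial
derivative of order `n` is given by the list `m` of the directions of differentiation. -/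
def atomicCoeff (χ η : E3 → ℝ) (M : ℕ) (L : ℝ) (v : E3 → E3) (q : ℕ)
    (k : Fin 3 → Fin (2 ^ q)) : ℝ≥0∞ :=
  ⨆ (n : ℕ) (_ : n ≤ M) (m : Fin n → Fin 3) (x : E3),
    ENNReal.ofReal ((waveNumber L q)⁻¹ ^ n) *
      ‖iteratedFDeriv ℝ n (localPiece χ η L v q k) x
        (fun j => EuclideanSpace.single (m j) (1 : ℝ))‖ₑ

/-- The activity threshold `σ_q ⟨|u_q|³⟩ / ⟨|u_q|²⟩`. -/
def threshold (χ : E3 → ℝ) (L T : ℝ) (u : ℝ → E3 → E3) (σ : ℕ → ℝ) (q : ℕ) : ℝ≥0∞ :=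
  ENNReal.ofReal (σ q) * (meanPow χ L T u q 3 / meanPow χ L T u q 2)

/-- The active region `A_q(t)` at time `t`. -/
def activeSlice (χ η : E3 → ℝ) (M : ℕ) (L T : ℝ) (u : ℝ → E3 → E3) (σ : ℕ → ℝ) (q : ℕ)
    (t : ℝ) : Set E3 :=
  ⋃ (k : Fin 3 → Fin (2 ^ q))
    (_ : threshold χ L T u σ q < atomicCoeff χ η M L (u t) q k), dilatedCube L q k

/-- The active region `A_q ⊆ Ω_T`. -/
def activeRegion (χ η : E3 → ℝ) (M : ℕ) (L T : ℝ) (u : ℝ → E3 → E3) (σ : ℕ → ℝ) (q : ℕ) :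
    Set (ℝ × E3) :=
  {z | z.1 ∈ Icc 0 T ∧ z.2 ∈ activeSlice χ η M L T u σ q z.1}

/-- The accumulant `A = limsup A_q`, the intersection over `p ≥ 1` of the unions over `q > p`. -/
def accumulant (χ η : E3 → ℝ) (M : ℕ) (L T : ℝ) (u : ℝ → E3 → E3) (σ : ℕ → ℝ) :
    Set (ℝ × E3) :=
  ⋂ (p : ℕ) (_ : 1 ≤ p), ⋃ (q : ℕ) (_ : p < q), activeRegion χ η M L T u σ q

/-- The time slice `A(t)` of a subset of space-time. -/
def timeSlice (A : Set (ℝ × E3)) (t : ℝ) : Set E3 := {x | (t, x) ∈ A}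

end Intermittency

end

open Intermittency

/-! The threshold is calibrated so that two pointwise comparisons, one on each side of it, give
everything.

Active side. The piece `u_q` is a trigonometric polynomial with frequencies of size at most `2 λ_q`,
so convolution with a fixed Schwartz kernel at scale `ℓ_q` reproduces it. Derivatives of order `n`
of `b_qk` are therefore at most `C λ_q ^ n` times a smeared modulus, the integral of `|u_q|` near
the point against the weight `(1 + |z|)⁻⁴`. The smeared modulus changes by a bounded factor over
distances comparable with `ℓ_q`, so it exceeds a fixed multiple of the threshold on the whole dilate
of an active cube (`exists_lt_smear_of_lt_atomicCoeff`). Chebyshev's inequality for third powers and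
Young's inequality on the torus (`lintegral_smear_pow_three_le`) then bound the volume by `C σ_q⁻³
V_q T` (`exists_measurable_superset_activeSlice`).

Inactive side. The mollified indicators form a partition of unity with at most 27 nonzero members at
each point, so off `A_q` one has `|u_q| ≤ 27 θ`, where `θ` is the threshold. Hence `|u_q|³ ≤ 27 θ
|u_q|²` there, and the definition of `θ` turns the integral of the right-hand side into at most `27
σ_q ∫ |u_q|³` (`lintegral_le_add_lintegral_activeRegion`).

Dimension. Let `N_q(t)` be the number of cubes in `A_q(t)`. For `d < s' < s`, the volume bound and
the subexponential size of `σ_q⁻³` make `∫ N_q(t) 2^(-sq) dt` decay geometrically, so `∑ N_q(t)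
2^(-sq)` is finite for a.e. `t` (`ae_tsum_card_activeIndices_ne_top`). For `s > 0` the tails of this
series control covers of `A(t)`, whose `s`-dimensional measure is thus zero. If `d < 0`, then `s =
0` is allowed, and a convergent series of integers forces `N_q(t) = 0` for large `q`. -/

namespace Intermittency

open scoped FourierTransform SchwartzMap

/-! ### Reproducing kernels for trigonometric polynomials -/

/-- A Schwartz function whose Fourier transform is `1` on the ball of radius `2`. -/
theorem exists_reproducing_kernel {χ : E3 → ℝ} (hχ : IsCutoff χ) :
    ∃ κ : 𝓢(E3, ℂ), ∀ ξ : E3, ‖ξ‖ ≤ 2 → 𝓕 (κ : E3 → ℂ) ξ = 1 := by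
  have hc : HasCompactSupport (fun ξ : E3 => (χ ((4 : ℝ)⁻¹ • ξ) : ℂ)) :=
    (hχ.compact.comp_smul (by norm_num : (4 : ℝ)⁻¹ ≠ 0)).comp_left (g := fun r : ℝ => (r : ℂ))
      Complex.ofReal_zero
  have hs : ContDiff ℝ ∞ (fun ξ : E3 => (χ ((4 : ℝ)⁻¹ • ξ) : ℂ)) :=
    Complex.ofRealCLM.contDiff.comp (hχ.smooth.comp (contDiff_const_smul _))
  refine ⟨𝓕⁻ (hc.toSchwartzMap hs), fun ξ hξ => ?_⟩
  rw [← SchwartzMap.fourier_coe, FourierTransform.fourier_fourierInv_eq]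
  simp only [HasCompactSupport.toSchwartzMap_toFun]
  have h : χ ((4 : ℝ)⁻¹ • ξ) = 1 := by
    apply hχ.eq_one
    rw [norm_smul]; norm_num; linarith
  change ((χ ((4 : ℝ)⁻¹ • ξ) : ℝ) : ℂ) = 1
  rw [h]; simp

/-- The plane wave `x ↦ exp (2πi ξ·x)`. -/
noncomputable def wave (ξ x : E3) : ℂ :=
  Complex.exp (2 * Real.pi * (inner ℝ ξ x : ℝ) * Complex.I)

theorem norm_wave (ξ x : E3) : ‖wave ξ x‖ = 1 := by
  rw [wave, show (2 * Real.pi * (inner ℝ ξ x : ℝ) * Complex.I : ℂ) =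
    ((2 * Real.pi * inner ℝ ξ x : ℝ) : ℂ) * Complex.I by push_cast; ring]
  exact Complex.norm_exp_ofReal_mul_I _

theorem wave_add (ξ x y : E3) : wave ξ (x + y) = wave ξ x * wave ξ y := by
  rw [wave, wave, wave, ← Complex.exp_add, inner_add_right]
  push_cast; ring_nf

theorem contDiff_wave (ξ : E3) : ContDiff ℝ ∞ (wave ξ) := by
  have h : ContDiff ℝ ∞ (fun x : E3 => (inner ℝ ξ x : ℝ)) := contDiff_const.inner ℝ contDiff_id
  have h2 : ContDiff ℝ ∞ (fun x : E3 => ((inner ℝ ξ x : ℝ) : ℂ)) :=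
    Complex.ofRealCLM.contDiff.comp h
  exact ((contDiff_const.mul h2).mul contDiff_const).cexp

theorem hasFDerivAt_wave (ξ x : E3) :
    HasFDerivAt (wave ξ)
      (wave ξ x • (2 * Real.pi * Complex.I : ℂ) • (Complex.ofRealCLM.comp (innerSL ℝ ξ))) x := by
  have h1 : HasFDerivAt (fun y : E3 => ((inner ℝ ξ y : ℝ) : ℂ))
      (Complex.ofRealCLM.comp (innerSL ℝ ξ)) x :=
    (Complex.ofRealCLM.comp (innerSL ℝ ξ)).hasFDerivAt
  have h2 := (h1.const_mul (2 * Real.pi * Complex.I : ℂ)).cexp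
  have e : ∀ y : E3, (2 * Real.pi * Complex.I : ℂ) * ((inner ℝ ξ y : ℝ) : ℂ) =
      2 * Real.pi * (inner ℝ ξ y : ℝ) * Complex.I := fun y => by ring
  simp only [e] at h2
  exact h2

theorem iteratedFDeriv_wave (ξ : E3) (n : ℕ) (x : E3) (h : Fin n → E3) :
    iteratedFDeriv ℝ n (wave ξ) x h =
      (∏ j, (2 * Real.pi * Complex.I * (inner ℝ ξ (h j) : ℝ) : ℂ)) * wave ξ x := by
  induction n generalizing x with
  | zero => simp
  | succ n ih =>
    rw [iteratedFDeriv_succ_apply_left]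
    have hd : DifferentiableAt ℝ (iteratedFDeriv ℝ n (wave ξ)) x :=
      ((contDiff_wave ξ).differentiable_iteratedFDeriv (by exact_mod_cast WithTop.coe_lt_top _)) x
    have h1 : HasFDerivAt (fun y => iteratedFDeriv ℝ n (wave ξ) y (Fin.tail h))
        ((ContinuousMultilinearMap.apply ℝ (fun _ : Fin n => E3) ℂ (Fin.tail h)).comp
          (fderiv ℝ (iteratedFDeriv ℝ n (wave ξ)) x)) x :=
      (ContinuousMultilinearMap.apply ℝ (fun _ : Fin n => E3) ℂ
        (Fin.tail h)).hasFDerivAt.comp x hd.hasFDerivAt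
    have h2 : (fun y => iteratedFDeriv ℝ n (wave ξ) y (Fin.tail h)) = fun y =>
        (∏ j, (2 * Real.pi * Complex.I * (inner ℝ ξ (Fin.tail h j) : ℝ) : ℂ)) * wave ξ y :=
      funext fun y => ih y _
    rw [h2] at h1
    have h3 := h1.unique ((hasFDerivAt_wave ξ x).const_mul _)
    have h4 := congrArg (fun l : E3 →L[ℝ] ℂ => l (h 0)) h3
    simp only [ContinuousLinearMap.comp_apply, ContinuousMultilinearMap.apply_apply] at h4
    rw [h4, Fin.prod_univ_succ]
    simp [Fin.tail]
    ring

theorem contDiff_schwartz (κ : 𝓢(E3, ℂ)) : ContDiff ℝ ∞ κ := κ.smooth ⊤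

theorem integrable_iteratedFDeriv_schwartz (κ : 𝓢(E3, ℂ)) (n : ℕ) :
    Integrable (iteratedFDeriv ℝ n κ) := by
  have h := κ.integrable_pow_mul_iteratedFDeriv volume 0 n
  simp only [pow_zero, one_mul] at h
  have := secondCountableTopologyEither_of_left E3 (ContinuousMultilinearMap ℝ (fun _ : Fin n => E3) ℂ)
  exact (integrable_norm_iff ((contDiff_schwartz κ).continuous_iteratedFDeriv
    (by exact_mod_cast le_top)).aestronglyMeasurable).1 h

theorem integrable_iteratedFDeriv_apply (κ : 𝓢(E3, ℂ)) (n : ℕ) (h : Fin n → E3) :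
    Integrable (fun z => iteratedFDeriv ℝ n κ z h) :=
  (ContinuousMultilinearMap.apply ℝ (fun _ : Fin n => E3) ℂ h).integrable_comp
    (integrable_iteratedFDeriv_schwartz κ n)

/-- Once the factor depending on `x` is taken out, the integral is the Fourier transform of a
derivative of `κ` at `ζ`. Derivatives become factors `2πi ζ·h`, and the transform of `κ` itself is
`1` at `ζ`. -/
theorem integral_wave_mul_iteratedFDeriv {κ : 𝓢(E3, ℂ)}
    (hκ : ∀ ξ : E3, ‖ξ‖ ≤ 2 → 𝓕 (κ : E3 → ℂ) ξ = 1) {ζ : E3} (hζ : ‖ζ‖ ≤ 2) {r : ℝ} (hr : r ≠ 0)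
    (n : ℕ) (h : Fin n → E3) (x : E3) :
    ∫ z, iteratedFDeriv ℝ n κ z h * wave (r • ζ) (x - r⁻¹ • z) =
      (∏ j, (2 * Real.pi * Complex.I * (inner ℝ ζ (h j) : ℝ) : ℂ)) * wave (r • ζ) x := by
  have e : ∀ z, iteratedFDeriv ℝ n κ z h * wave (r • ζ) (x - r⁻¹ • z) =
      wave (r • ζ) x * (Complex.exp (((-2 * Real.pi * inner ℝ z ζ : ℝ) : ℂ) * Complex.I) •
        iteratedFDeriv ℝ n κ z h) := by
    intro z
    rw [sub_eq_add_neg, wave_add, smul_eq_mul]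
    have : wave (r • ζ) (-(r⁻¹ • z)) =
        Complex.exp (((-2 * Real.pi * inner ℝ z ζ : ℝ) : ℂ) * Complex.I) := by
      rw [wave, inner_neg_right, real_inner_smul_left, real_inner_smul_right,
        ← mul_assoc, mul_inv_cancel₀ hr, one_mul, real_inner_comm]
      congr 1
      push_cast; ring
    rw [this]; ring
  simp_rw [e]
  rw [integral_const_mul, mul_comm]
  congr 1
  have hF := congrFun (Real.fourier_iteratedFDeriv (N := ⊤) (f := (κ : E3 → ℂ))
    (contDiff_schwartz κ) (fun n _ => integrable_iteratedFDeriv_schwartz κ n) (n := n) le_top) ζ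
  have hA := congrArg (ContinuousMultilinearMap.apply ℝ (fun _ : Fin n => E3) ℂ h) hF
  rw [Real.fourier_eq', ← ContinuousLinearMap.integral_comp_comm] at hA
  · simp only [ContinuousMultilinearMap.apply_apply, VectorFourier.fourierPowSMulRight_apply,
      smul_apply] at hA
    rw [hA, hκ ζ hζ]
    -- The `n` signs from the pairing `-innerSL ℝ` cancel those of `(-2πi) ^ n`.
    have e2 : ∀ j, ((-innerSL ℝ) ζ) (h j) = -inner ℝ ζ (h j) := fun j => by
      simp [innerSL_apply_apply]
    simp only [e2, Finset.prod_mul_distrib, Finset.prod_const, Finset.card_univ, Fintype.card_fin,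
      Finset.prod_neg, smul_eq_mul, mul_one, Complex.real_smul]
    push_cast
    rw [← mul_assoc, ← mul_pow]
    ring_nf
  · have := secondCountableTopologyEither_of_left E3
      (ContinuousMultilinearMap ℝ (fun _ : Fin n => E3) ℂ)
    refine (integrable_iteratedFDeriv_schwartz κ n).mono (Continuous.aestronglyMeasurable ?_) ?_
    · have hexp : Continuous fun v : E3 =>
          Complex.exp (((-2 * Real.pi * inner ℝ v ζ : ℝ) : ℂ) * Complex.I) := by fun_prop
      exact hexp.smul <| (contDiff_schwartz κ).continuous_iteratedFDeriv (by exact_mod_cast le_top)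
    · exact Eventually.of_forall fun z => by
        rw [norm_smul, Complex.norm_exp_ofReal_mul_I, one_mul]

/-- A trigonometric polynomial with values in `C3`. -/
noncomputable def trigPoly {ι : Type} (S : Finset ι) (ξ : ι → E3) (a : ι → C3) (x : E3) : C3 :=
  ∑ m ∈ S, wave (ξ m) x • a m

variable {ι : Type} {S : Finset ι} {a : ι → C3}

theorem contDiff_trigPoly {ξ : ι → E3} : ContDiff ℝ ∞ (trigPoly S ξ a) :=
  ContDiff.sum fun _ _ => (contDiff_wave _).smul contDiff_const

theorem norm_trigPoly_le {ξ : ι → E3} (x : E3) : ‖trigPoly S ξ a x‖ ≤ ∑ m ∈ S, ‖a m‖ :=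
  (norm_sum_le _ _).trans (Finset.sum_le_sum fun m _ => by simp [norm_smul, norm_wave])

theorem iteratedFDeriv_trigPoly {ξ : ι → E3} (n : ℕ) (x : E3) (h : Fin n → E3) :
    iteratedFDeriv ℝ n (trigPoly S ξ a) x h =
      ∑ m ∈ S, iteratedFDeriv ℝ n (wave (ξ m)) x h • a m := by
  have h1 : trigPoly S ξ a = fun x => ∑ m ∈ S, wave (ξ m) x • a m := rfl
  rw [h1, iteratedFDeriv_sum (f := fun m x => wave (ξ m) x • a m) fun m _ =>
    ((contDiff_wave (ξ m)).smul (contDiff_const (c := a m))).of_le (by exact_mod_cast le_top),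
    Finset.sum_apply, _root_.sum_apply]
  refine Finset.sum_congr rfl fun m _ => ?_
  have h2 : (fun x => wave (ξ m) x • a m) =
    (ContinuousLinearMap.toSpanSingleton ℂ (a m)).restrictScalars ℝ ∘ wave (ξ m) := by
      ext; simp
  rw [h2, ContinuousLinearMap.iteratedFDeriv_comp_left (n := n) _ (((contDiff_wave _)).of_le (by exact_mod_cast le_top)).contDiffAt le_rfl]
  simp

/-- By linearity from plane waves: convolution with the kernel at scale `1/r` fixes all frequencies
up to `2r`, so derivatives can be moved to the kernel at the price of a factor `r` each. -/
theorem iteratedFDeriv_trigPoly_eq_integral {κ : 𝓢(E3, ℂ)}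
    (hκ : ∀ ξ : E3, ‖ξ‖ ≤ 2 → 𝓕 (κ : E3 → ℂ) ξ = 1) {ζ : ι → E3} (hζ : ∀ m ∈ S, ‖ζ m‖ ≤ 2)
    {r : ℝ} (hr : r ≠ 0) (n : ℕ) (h : Fin n → E3) (x : E3) :
    iteratedFDeriv ℝ n (trigPoly S (fun m => r • ζ m) a) x h =
      (r ^ n : ℂ) • ∫ z, iteratedFDeriv ℝ n κ z h •
        trigPoly S (fun m => r • ζ m) a (x - r⁻¹ • z) := by
  simp only [trigPoly, Finset.smul_sum, smul_smul]
  rw [integral_finsetSum]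
  · rw [Finset.smul_sum]
    have := iteratedFDeriv_trigPoly (S := S) (a := a) (ξ := fun m => r • ζ m) n x h
    refine this.trans ?_
    refine Finset.sum_congr rfl fun m hm => ?_
    rw [integral_smul_const, integral_wave_mul_iteratedFDeriv hκ (hζ m hm) hr, iteratedFDeriv_wave,
      smul_smul]
    congr 1
    simp only [real_inner_smul_left]
    rw [← mul_assoc]
    congr 1
    have e : (r : ℂ) ^ n = ∏ _j : Fin n, (r : ℂ) := by simp
    rw [e, ← Finset.prod_mul_distrib]
    refine Finset.prod_congr rfl fun j _ => ?_
    push_cast; ring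
  · intro m _
    refine Integrable.smul_const ?_ _
    refine (integrable_iteratedFDeriv_apply κ n h).mul_bdd (c := 1) ?_ ?_
    · exact (((contDiff_wave _).continuous).comp (by fun_prop)).aestronglyMeasurable
    · exact Eventually.of_forall fun z => (norm_wave _ _).le

/-! ### The smeared modulus -/

/-- The weight `(1 + |z|)⁻⁴`. -/
noncomputable def weight (z : E3) : ℝ≥0∞ := ENNReal.ofReal (((1 + ‖z‖) ^ 4)⁻¹)

theorem measurable_weight : Measurable weight := by unfold weight; fun_prop

/-- The exponent `4` exceeds the dimension `3`. -/
theorem lintegral_weight_ne_top : ∫⁻ z, weight z ≠ ⊤ := by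
  have h := finite_integral_one_add_norm (E := E3) (μ := volume) (r := 4) (by simp; norm_num)
  refine (lt_of_eq_of_lt (lintegral_congr fun z => ?_) h).ne
  rw [weight, Real.rpow_neg (by positivity)]
  norm_cast

/-- The average `∫ |F(x - z/r)| (1 + |z|)⁻⁴ dz` of the modulus of `F` at scale `1/r`. -/
noncomputable def smear (r : ℝ) (F : E3 → C3) (x : E3) : ℝ≥0∞ :=
  ∫⁻ z, ‖F (x - r⁻¹ • z)‖ₑ * weight z

theorem smear_trigPoly_ne_top {ξ : ι → E3} (r : ℝ) (x : E3) : smear r (trigPoly S ξ a) x ≠ ⊤ := by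
  refine ((lintegral_mono (g := fun z => ENNReal.ofReal (∑ m ∈ S, ‖a m‖) * weight z)
    fun z => ?_).trans_lt ?_).ne
  · refine mul_le_mul_left ?_ _
    rw [← ofReal_norm]
    exact ENNReal.ofReal_le_ofReal (norm_trigPoly_le _)
  · rw [lintegral_const_mul _ measurable_weight]
    exact ENNReal.mul_lt_top ENNReal.ofReal_lt_top lintegral_weight_ne_top.lt_top

/-- Bernstein's inequality in terms of the smeared modulus. -/
theorem exists_enorm_iteratedFDeriv_trigPoly_le {χ : E3 → ℝ} (hχ : IsCutoff χ) (n : ℕ) :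
    ∃ C : ℝ, 0 ≤ C ∧ ∀ (ι : Type) (S : Finset ι) (a : ι → C3) (ζ : ι → E3),
      (∀ m ∈ S, ‖ζ m‖ ≤ 2) → ∀ (r : ℝ), 0 < r → ∀ x,
      ‖iteratedFDeriv ℝ n (trigPoly S (fun m => r • ζ m) a) x‖ₑ ≤
        ENNReal.ofReal (C * r ^ n) * smear r (trigPoly S (fun m => r • ζ m) a) x := by
  obtain ⟨κ, hκ⟩ := exists_reproducing_kernel hχ
  set C : ℝ := 2 ^ 4 * (Finset.Iic (4, n)).sup (fun m => SchwartzMap.seminorm ℝ m.1 m.2) κ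
  have hC0 : 0 ≤ C := mul_nonneg (by norm_num) (apply_nonneg _ _)
  have hC : ∀ z, ‖iteratedFDeriv ℝ n κ z‖ ≤ C * ((1 + ‖z‖) ^ 4)⁻¹ := fun z => by
    have := SchwartzMap.one_add_le_sup_seminorm_apply (𝕜 := ℝ) (m := (4, n)) (k := 4) (n := n)
      le_rfl le_rfl κ z
    rw [← div_eq_mul_inv, le_div_iff₀ (by positivity), mul_comm]
    exact this
  refine ⟨C, hC0, fun ι S a ζ hζ r hr x => ?_⟩
  set F := trigPoly S (fun m => r • ζ m) a
  -- Finiteness permits the passage to real numbers, in which the operator norm is bounded by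
  -- testing on vectors.
  have hfin : smear r F x ≠ ⊤ := smear_trigPoly_ne_top r x
  have key : ‖iteratedFDeriv ℝ n F x‖ ≤ C * r ^ n * (smear r F x).toReal := by
    refine ContinuousMultilinearMap.opNorm_le_bound (by positivity) fun h => ?_
    have h1 : ‖iteratedFDeriv ℝ n F x h‖ₑ ≤
        ENNReal.ofReal (C * r ^ n * ∏ i, ‖h i‖) * smear r F x := by
      rw [iteratedFDeriv_trigPoly_eq_integral hκ hζ hr.ne', enorm_smul]
      refine (mul_le_mul_right (enorm_integral_le_lintegral_enorm _) _).trans ?_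
      calc _ ≤ ‖(r ^ n : ℂ)‖ₑ * ∫⁻ z, ENNReal.ofReal (C * ∏ i, ‖h i‖) *
              (‖F (x - r⁻¹ • z)‖ₑ * weight z) := by
            gcongr with z
            rw [enorm_smul]
            have : ‖iteratedFDeriv ℝ n κ z h‖ₑ ≤
                ENNReal.ofReal (C * ∏ i, ‖h i‖) * weight z := by
              rw [← ofReal_norm, weight, ← ENNReal.ofReal_mul (by positivity)]
              apply ENNReal.ofReal_le_ofReal
              refine (ContinuousMultilinearMap.le_opNorm _ _).trans ?_
              calc _ ≤ (C * ((1 + ‖z‖) ^ 4)⁻¹) * ∏ i, ‖h i‖ := by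
                    gcongr; exact hC z
                _ = _ := by ring
            calc _ ≤ ENNReal.ofReal (C * ∏ i, ‖h i‖) * weight z * ‖F (x - r⁻¹ • z)‖ₑ := by gcongr
              _ = _ := by ring
        _ = _ := by
            rw [lintegral_const_mul, ← mul_assoc]
            · rw [← ofReal_norm, ← ENNReal.ofReal_mul (by positivity)]
              congr 2
              rw [norm_pow, Complex.norm_real, Real.norm_of_nonneg hr.le]; ring
            · refine Measurable.mul (Continuous.measurable ?_) measurable_weight
              exact (contDiff_trigPoly.continuous.comp (by fun_prop)).enorm
    have h2 := ENNReal.toReal_mono (ENNReal.mul_ne_top ENNReal.ofReal_ne_top hfin) h1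
    rw [toReal_enorm, ENNReal.toReal_mul, ENNReal.toReal_ofReal (by positivity)] at h2
    linarith
  rw [← ofReal_norm]
  refine (ENNReal.ofReal_le_ofReal key).trans ?_
  rw [ENNReal.ofReal_mul (by positivity), ENNReal.ofReal_toReal hfin]

/-- Peetre's inequality: `1 + |z| ≤ (1 + |v|) (1 + |z + v|)`. -/
theorem weight_le (z v : E3) (R : ℝ) (hv : ‖v‖ ≤ R) :
    weight (z + v) ≤ ENNReal.ofReal ((1 + R) ^ 4) * weight z := by
  have hR : 0 ≤ R := (norm_nonneg _).trans hv
  rw [weight, weight, ← ENNReal.ofReal_mul (by positivity)]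
  apply ENNReal.ofReal_le_ofReal
  rw [inv_le_iff_one_le_mul₀ (by positivity)]
  have h1 : 1 + ‖z‖ ≤ (1 + R) * (1 + ‖z + v‖) := by
    have : ‖z‖ ≤ ‖z + v‖ + ‖v‖ := by simpa using norm_sub_le (z + v) v
    nlinarith [norm_nonneg (z + v)]
  have h2 : (1 + ‖z‖) ^ 4 ≤ ((1 + R) * (1 + ‖z + v‖)) ^ 4 := by gcongr
  rw [mul_pow] at h2
  rw [mul_right_comm, ← div_eq_mul_inv, le_div_iff₀ (by positivity), one_mul]
  exact h2

/-- The smeared modulus varies slowly at scale `1/r`. -/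
theorem smear_le {r : ℝ} (hr : 0 < r) {F : E3 → C3} (hF : Continuous F) {R : ℝ} {x y : E3}
    (hxy : r * ‖y - x‖ ≤ R) : smear r F y ≤ ENNReal.ofReal ((1 + R) ^ 4) * smear r F x := by
  -- Translating the variable moves the displacement from `F` to the weight.
  have h1 : smear r F y = ∫⁻ z, ‖F (x - r⁻¹ • z)‖ₑ * weight (z + r • (y - x)) := by
    rw [smear, ← lintegral_add_right_eq_self _ (r • (y - x))]
    refine lintegral_congr fun z => ?_
    rw [smul_add, smul_smul, inv_mul_cancel₀ hr.ne', one_smul]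
    congr 3
    rw [add_comm, ← sub_sub, sub_sub_cancel]
  rw [h1, smear, ← lintegral_const_mul]
  · refine lintegral_mono fun z => ?_
    rw [mul_left_comm]
    gcongr
    exact weight_le _ _ _ (by rwa [norm_smul, Real.norm_of_nonneg hr.le])
  · exact (hF.comp (by fun_prop : Continuous fun z => x - r⁻¹ • z)).enorm.measurable.mul
      measurable_weight

end Intermittency

namespace Intermittency

open scoped Pointwise

/-! ### Integration of periodic functions -/

/-- The element `L n` of the period lattice `L ℤ³`. -/
noncomputable def period (L : ℝ) (n : Fin 3 → ℤ) : E3 := WithLp.toLp 2 (fun i => L * (n i : ℝ))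

@[simp] theorem period_apply (L : ℝ) (n : Fin 3 → ℤ) (i : Fin 3) : period L n i = L * n i := rfl

/-- The basis `L e₁, L e₂, L e₃`. -/
noncomputable def periodBasis {L : ℝ} (hL : 0 < L) : Module.Basis (Fin 3) ℝ E3 :=
  (EuclideanSpace.basisFun (Fin 3) ℝ).toBasis.isUnitSMul (fun _ => hL.ne'.isUnit)

theorem fundamentalDomain_periodBasis {L : ℝ} (hL : 0 < L) :
    ZSpan.fundamentalDomain (periodBasis hL) = box L := by
  ext x
  simp only [ZSpan.mem_fundamentalDomain, periodBasis, box, Set.mem_ofPred_eq, Set.mem_Ico]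
  refine forall_congr' fun i => ?_
  rw [Module.Basis.repr_isUnitSMul]
  have : (hL.ne'.isUnit.unit⁻¹ : ℝˣ) • ((EuclideanSpace.basisFun (Fin 3) ℝ).toBasis.repr x i) =
      L⁻¹ * x i := by
    simp [Units.smul_def]
  rw [this, ← div_eq_inv_mul, div_lt_one hL, le_div_iff₀ hL, zero_mul]

theorem measurableSet_box (L : ℝ) : MeasurableSet (box L) := by
  have : box L = ⋂ i : Fin 3, {x | 0 ≤ x i} ∩ {x | x i < L} := by
    ext x; simp [box]
  rw [this]
  exact MeasurableSet.iInter fun i =>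
    (measurableSet_le measurable_const (by fun_prop)).inter
      (measurableSet_lt (by fun_prop) measurable_const)

theorem volume_Ico_pi {a b : Fin 3 → ℝ} :
    volume {x : E3 | ∀ i, a i ≤ x i ∧ x i < b i} = ∏ i, ENNReal.ofReal (b i - a i) := by
  rw [← Real.volume_pi_Ico,
    ← (PiLp.volume_preserving_ofLp (Fin 3)).measure_preimage
      (MeasurableSet.univ_pi fun i => measurableSet_Ico).nullMeasurableSet]
  congr 1
  ext x
  simp

theorem volume_box {L : ℝ} (hL : 0 < L) : volume (box L) = ENNReal.ofReal (L ^ 3) := by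
  have := volume_Ico_pi (a := fun _ => 0) (b := fun _ => L)
  rw [box, this]
  simp [ENNReal.ofReal_pow hL.le]

/-- The box and its translate are both fundamental domains of the period lattice, so a periodic
function has the same integral over each. -/
theorem setLIntegral_box_sub {L : ℝ} (hL : 0 < L) (f : E3 → ℝ≥0∞)
    (hf : ∀ x n, f (x + period L n) = f x) (v : E3) :
    ∫⁻ x in box L, f (x - v) = ∫⁻ x in box L, f x := by
  have hD := ZSpan.isAddFundamentalDomain (periodBasis hL) (volume : Measure E3)
  have hD' := hD.vadd_of_comm (-v)
  have hinv : ∀ (g : Submodule.span ℤ (Set.range (periodBasis hL))) (x : E3),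
      f (g +ᵥ x) = f x := by
    rintro ⟨g, hg⟩ x
    obtain ⟨c, hc⟩ := (Submodule.mem_span_range_iff_exists_fun ℤ).1 hg
    have : (⟨g, hg⟩ : Submodule.span ℤ (Set.range (periodBasis hL))) +ᵥ x =
        x + period L c := by
      rw [Submodule.vadd_def, vadd_eq_add, add_comm]
      congr 1
      change g = period L c
      rw [← hc]
      ext i
      simp [periodBasis, Module.Basis.isUnitSMul_apply, period, Finset.sum_apply, Pi.single_apply,
        mul_comm]
    rw [this, hf]
  have : VAddInvariantMeasure (Submodule.span ℤ (Set.range (periodBasis hL))) E3 volume :=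
    inferInstanceAs (VAddInvariantMeasure
      (Submodule.span ℤ (Set.range (periodBasis hL))).toAddSubgroup E3 volume)
  have h1 := hD.setLIntegral_eq hD' f hinv
  rw [fundamentalDomain_periodBasis hL] at h1
  rw [h1]
  have h2 : (-v) +ᵥ box L = (fun x => x - v) '' box L := by
    ext x
    simp [Set.mem_vadd_set, vadd_eq_add, neg_add_eq_sub]
  rw [h2]
  exact ((measurePreserving_sub_right volume v).setLIntegral_comp_emb
    (Homeomorph.subRight v).measurableEmbedding f (box L))

/-! ### Young's inequality for the smeared modulus -/

/-- Hölder's inequality for `f` and `1` with respect to the measure `w μ`. The case `n = 2` serves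
Young's inequality; the case `n = 1` is Cauchy-Schwarz. -/
theorem lintegral_mul_pow_succ_le {α : Type*} [MeasurableSpace α] {μ : Measure α}
    {f w : α → ℝ≥0∞} (hf : AEMeasurable f μ) (hw : Measurable w) {n : ℕ} (hn : n ≠ 0) :
    (∫⁻ z, f z * w z ∂μ) ^ (n + 1) ≤ (∫⁻ z, w z ∂μ) ^ n * ∫⁻ z, f z ^ (n + 1) * w z ∂μ := by
  have h1 : ∀ g : α → ℝ≥0∞, AEMeasurable g μ →
      ∫⁻ z, g z ∂(μ.withDensity w) = ∫⁻ z, g z * w z ∂μ := fun g hg => by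
    rw [lintegral_withDensity_eq_lintegral_mul₀ hw.aemeasurable hg]
    exact lintegral_congr fun z => mul_comm _ _
  have hn0 : (0 : ℝ) < n := by positivity
  have hpq : Real.HolderConjugate ((n + 1 : ℕ) : ℝ) ((n + 1 : ℕ) / n) := by
    rw [Real.holderConjugate_iff]
    push_cast
    exact ⟨by linarith, by field_simp; ring⟩
  have h2 := ENNReal.lintegral_mul_le_Lp_mul_Lq (μ.withDensity w) hpq
    (hf.mono_ac (withDensity_absolutelyContinuous _ _))
    (measurable_const (a := (1 : ℝ≥0∞))).aemeasurable
  simp only [Pi.mul_apply, mul_one, ENNReal.one_rpow, lintegral_const, one_mul,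
    ENNReal.rpow_natCast] at h2
  have h3 : (μ.withDensity w) univ = ∫⁻ z, w z ∂μ := by
    rw [withDensity_apply _ MeasurableSet.univ, Measure.restrict_univ]
  rw [h1 f hf, h1 _ (hf.pow_const (n + 1)), h3] at h2
  calc _ ≤ _ := pow_le_pow_left₀ zero_le h2 (n + 1)
    _ = _ := by
      rw [mul_pow, mul_comm]
      congr 1
      · rw [← ENNReal.rpow_natCast, ← ENNReal.rpow_mul, ← ENNReal.rpow_natCast]
        congr 1
        field_simp
      · rw [← ENNReal.rpow_natCast, ← ENNReal.rpow_mul, one_div,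
          inv_mul_cancel₀ (by positivity), ENNReal.rpow_one]

/-- Hölder in `z`, then Tonelli, then translation invariance over a period. The constant does not
depend on the scale `r`. -/
theorem lintegral_smear_pow_three_le {L : ℝ} (hL : 0 < L) (r : ℝ) {F : E3 → C3}
    (hF : Measurable F) (hper : ∀ x n, F (x + period L n) = F x) :
    ∫⁻ x in box L, smear r F x ^ 3 ≤
      (∫⁻ z, weight z) ^ 3 * ∫⁻ x in box L, ‖F x‖ₑ ^ 3 := by
  have hm : Measurable (Function.uncurry fun x z : E3 => ‖F (x - r⁻¹ • z)‖ₑ) :=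
    (hF.comp (by fun_prop : Measurable fun p : E3 × E3 => p.1 - r⁻¹ • p.2)).enorm
  have hw := measurable_weight
  have hm3 : Measurable fun p : E3 × E3 => ‖F (p.1 - r⁻¹ • p.2)‖ₑ ^ 3 * weight p.2 := by
    have : Measurable fun p : E3 × E3 => ‖F (p.1 - r⁻¹ • p.2)‖ₑ := hm
    exact (this.pow_const 3).mul (hw.comp measurable_snd)
  calc ∫⁻ x in box L, smear r F x ^ 3
      ≤ ∫⁻ x in box L, (∫⁻ z, weight z) ^ 2 * ∫⁻ z, ‖F (x - r⁻¹ • z)‖ₑ ^ 3 * weight z := by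
        refine lintegral_mono fun x => ?_
        have hx : Measurable fun z => ‖F (x - r⁻¹ • z)‖ₑ := by fun_prop
        exact lintegral_mul_pow_succ_le hx.aemeasurable hw two_ne_zero
    _ = (∫⁻ z, weight z) ^ 2 *
          ∫⁻ z, ∫⁻ x in box L, ‖F (x - r⁻¹ • z)‖ₑ ^ 3 * weight z := by
        rw [lintegral_const_mul, lintegral_lintegral_swap]
        · exact hm3.aemeasurable
        · exact hm3.lintegral_prod_right
    _ = (∫⁻ z, weight z) ^ 2 * ∫⁻ z, (∫⁻ x in box L, ‖F x‖ₑ ^ 3) * weight z := by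
        congr 2
        ext z
        rw [lintegral_mul_const]
        · rw [setLIntegral_box_sub hL (fun x => ‖F x‖ₑ ^ 3) (fun x n => by rw [hper])]
        · exact Measurable.pow_const (Measurable.enorm (hF.comp (measurable_id.sub_const _))) 3
    _ = _ := by
        rw [lintegral_const_mul _ hw]; ring

end Intermittency

namespace Intermittency

/-! ### Convolution of bounded functions with smooth kernels -/

theorem locallyIntegrable_of_bounded {P : E3 → ℝ} (hP : Measurable P) (hP1 : ∀ x, ‖P x‖ ≤ 1) :
    LocallyIntegrable P :=
  (locallyIntegrable_const (1 : ℝ)).mono hP.aestronglyMeasurable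
    (Eventually.of_forall fun x => by simpa using hP1 x)

/-- All derivatives fall on the smooth factor. The target space is arbitrary because the induction
replaces `h` by `fderiv ℝ h`. -/
theorem norm_iteratedFDeriv_convolution_le {P : E3 → ℝ} (hP : Measurable P)
    (hP1 : ∀ x, ‖P x‖ ≤ 1) (n : ℕ) :
    ∀ {V : Type} [NormedAddCommGroup V] [NormedSpace ℝ V] {h : E3 → V},
      ContDiff ℝ ∞ h → HasCompactSupport h → ∀ x,
      ‖iteratedFDeriv ℝ n (convolution P h (ContinuousLinearMap.lsmul ℝ ℝ) volume) x‖ ≤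
        ∫ y, ‖iteratedFDeriv ℝ n h y‖ := by
  induction n with
  | zero =>
    intro V _ _ h hh hc x
    simp only [norm_iteratedFDeriv_zero, convolution_def]
    rw [← integral_sub_left_eq_self (fun y => ‖h y‖) volume x]
    refine norm_integral_le_of_norm_le ?_ (Eventually.of_forall fun t => ?_)
    · exact ((hh.continuous.integrable_of_hasCompactSupport hc).comp_sub_left x).norm
    · rw [ContinuousLinearMap.lsmul_apply, norm_smul]
      exact mul_le_of_le_one_left (norm_nonneg _) (hP1 t)
  | succ n ih =>
    intro V _ _ h hh hc x
    have h1 : fderiv ℝ (convolution P h (ContinuousLinearMap.lsmul ℝ ℝ) volume) =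
        convolution P (fderiv ℝ h) (ContinuousLinearMap.lsmul ℝ ℝ) volume := by
      ext1 y
      rw [(hc.hasFDerivAt_convolution_right (ContinuousLinearMap.lsmul ℝ ℝ)
        (locallyIntegrable_of_bounded hP hP1) (hh.of_le (by exact_mod_cast le_top)) y).fderiv]
      rfl
    rw [← norm_iteratedFDeriv_fderiv, h1]
    simp_rw [← norm_iteratedFDeriv_fderiv (n := n) (f := h)]
    exact ih (hh.fderiv_right (by norm_cast)) (hc.fderiv ℝ) x

/-! ### Dyadic cubes and their periodic extensions -/

theorem waveNumber_pos {L : ℝ} (hL : 0 < L) (q : ℕ) : 0 < waveNumber L q := by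
  unfold waveNumber; positivity

theorem lengthScale_pos {L : ℝ} (hL : 0 < L) (q : ℕ) : 0 < lengthScale L q := by
  unfold lengthScale; positivity

theorem inv_waveNumber (L : ℝ) (q : ℕ) : (waveNumber L q)⁻¹ = lengthScale L q := by
  simp [waveNumber, lengthScale]

theorem lengthScale_mul_pow (L : ℝ) (q : ℕ) : lengthScale L q * 2 ^ q = L := by
  simp [lengthScale]

/-- Integer coordinates of the cube of the lattice `ℓ_q ℤ³` that contains `y`. -/
noncomputable def floorIndex (L : ℝ) (q : ℕ) (y : E3) (i : Fin 3) : ℤ := ⌊y i / lengthScale L q⌋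

/-- Reduction of integer coordinates modulo `2^q`. -/
def reduce (q : ℕ) (a : Fin 3 → ℤ) (i : Fin 3) : Fin (2 ^ q) :=
  ⟨(a i % 2 ^ q).toNat, by
    have h1 := Int.emod_lt_of_pos (a i) (by positivity : (0 : ℤ) < 2 ^ q)
    have h2 := Int.emod_nonneg (a i) (by positivity : (2 : ℤ) ^ q ≠ 0)
    zify
    rw [Int.toNat_of_nonneg h2]
    exact_mod_cast h1⟩

theorem reduce_coe (q : ℕ) (a : Fin 3 → ℤ) (i : Fin 3) :
    ((reduce q a i : ℕ) : ℤ) = a i % 2 ^ q :=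
  Int.toNat_of_nonneg (Int.emod_nonneg (a i) (by positivity : (2 : ℤ) ^ q ≠ 0))

theorem mem_cube_iff {L : ℝ} (hL : 0 < L) {q : ℕ} {k : Fin 3 → Fin (2 ^ q)} {y : E3} :
    y ∈ cube L q k ↔ ∀ i, floorIndex L q y i = ((k i : ℕ) : ℤ) := by
  have hl := lengthScale_pos hL q
  refine forall_congr' fun i => ?_
  rw [floorIndex, Int.floor_eq_iff, le_div_iff₀ hl, div_lt_iff₀ hl, mul_comm, mul_comm (_ + 1)]
  push_cast
  rfl

theorem floorIndex_add_period {L : ℝ} (hL : 0 < L) (q : ℕ) (y : E3) (n : Fin 3 → ℤ) (i : Fin 3) :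
    floorIndex L q (y + period L n) i = floorIndex L q y i + 2 ^ q * n i := by
  have hl := lengthScale_pos hL q
  have : (y + period L n) i / lengthScale L q =
      y i / lengthScale L q + ((2 ^ q * n i : ℤ) : ℝ) := by
    rw [PiLp.add_apply, period_apply, add_div]
    congr 1
    rw [div_eq_iff hl.ne']
    nth_rewrite 1 [← lengthScale_mul_pow L q]
    push_cast; ring
  rw [floorIndex, this, Int.floor_add_intCast, floorIndex]

/-- A period shifts the integer coordinates by multiples of `2^q`. Consequently the periodic cubes
partition the whole space. -/
theorem mem_periodicCube_iff {L : ℝ} (hL : 0 < L) {q : ℕ} {k : Fin 3 → Fin (2 ^ q)} {y : E3} :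
    y ∈ periodicCube L q k ↔ reduce q (floorIndex L q y) = k := by
  have h1 : y ∈ periodicCube L q k ↔ ∃ n, y + period L n ∈ cube L q k := Iff.rfl
  rw [h1]
  simp only [mem_cube_iff hL, floorIndex_add_period hL]
  constructor
  · rintro ⟨n, hn⟩
    ext i
    zify
    rw [reduce_coe, ← hn i]
    have hk : (((k i : ℕ) : ℤ)) < 2 ^ q := by exact_mod_cast (k i).2
    have h0 : (0 : ℤ) ≤ ((k i : ℕ) : ℤ) := by positivity
    rw [← hn i] at hk h0
    rw [← Int.add_mul_emod_self_left _ (2 ^ q) (n i), Int.emod_eq_of_lt h0 hk]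
  · rintro rfl
    refine ⟨fun i => -(floorIndex L q y i / 2 ^ q), fun i => ?_⟩
    rw [reduce_coe]
    have := Int.emod_add_mul_ediv (floorIndex L q y i) (2 ^ q)
    linarith

theorem measurableSet_cube (L : ℝ) (q : ℕ) (k : Fin 3 → Fin (2 ^ q)) :
    MeasurableSet (cube L q k) := by
  have : cube L q k = ⋂ i : Fin 3, {x | lengthScale L q * ((k i : ℕ) : ℝ) ≤ x i} ∩
      {x | x i < lengthScale L q * (((k i : ℕ) : ℝ) + 1)} := by
    ext x; simp [cube]
  rw [this]
  exact MeasurableSet.iInter fun i =>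
    (measurableSet_le measurable_const (by fun_prop)).inter
      (measurableSet_lt (by fun_prop) measurable_const)

theorem measurableSet_periodicCube (L : ℝ) (q : ℕ) (k : Fin 3 → Fin (2 ^ q)) :
    MeasurableSet (periodicCube L q k) := by
  have : periodicCube L q k = ⋃ n : Fin 3 → ℤ, (fun x => x + period L n) ⁻¹' cube L q k := by
    ext x; simp [periodicCube, period]
  rw [this]
  exact MeasurableSet.iUnion fun n => measurable_id.add_const _ (measurableSet_cube L q k)

theorem volume_cube (L : ℝ) (q : ℕ) (k : Fin 3 → Fin (2 ^ q)) :
    volume (cube L q k) = ENNReal.ofReal (lengthScale L q) ^ 3 := by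
  rw [cube, volume_Ico_pi]
  have : ∀ x : ℝ, lengthScale L q * (x + 1) - lengthScale L q * x = lengthScale L q :=
    fun x => by ring
  simp [this]

theorem cube_subset_box {L : ℝ} (hL : 0 < L) (q : ℕ) (k : Fin 3 → Fin (2 ^ q)) :
    cube L q k ⊆ box L := fun x hx i => by
  have hl := lengthScale_pos hL q
  refine ⟨le_trans (by positivity) (hx i).1, (hx i).2.trans_le ?_⟩
  nth_rewrite 2 [← lengthScale_mul_pow L q]
  gcongr
  exact_mod_cast (k i).2

theorem pairwise_disjoint_cube {L : ℝ} (hL : 0 < L) (q : ℕ) :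
    Pairwise (Function.onFun Disjoint (cube L q)) := fun k k' hk => by
  refine Set.disjoint_left.2 fun x hx hx' => hk ?_
  rw [mem_cube_iff hL] at hx hx'
  ext i
  have := (hx i).symm.trans (hx' i)
  exact_mod_cast this

/-- Every point of the box lies in the cube given by its reduced integer coordinates. -/
theorem mem_cube_reduce {L : ℝ} (hL : 0 < L) (q : ℕ) {x : E3} (hx : x ∈ box L) :
    x ∈ cube L q (reduce q (floorIndex L q x)) := by
  have hl := lengthScale_pos hL q
  rw [mem_cube_iff hL]
  intro i
  rw [reduce_coe, Int.emod_eq_of_lt]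
  · exact Int.floor_nonneg.2 (div_nonneg (hx i).1 hl.le)
  · rw [floorIndex, Int.floor_lt, div_lt_iff₀ hl]
    push_cast
    rw [mul_comm, lengthScale_mul_pow]
    exact (hx i).2

/-! ### The mollified indicators -/

section SmoothIndicator

variable {η : E3 → ℝ} {L : ℝ} {q : ℕ} {k : Fin 3 → Fin (2 ^ q)}

theorem IsMollifier.hasCompactSupport (hη : IsMollifier η) : HasCompactSupport η :=
  (isCompact_closedBall (0 : E3) 1).of_isClosed_subset (isClosed_tsupport η) hη.supp

/-- Under `z = λ_q y` the factors `L⁻³`, `2^(3q)` and the Jacobian `λ_q⁻³` multiply to `1`. -/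
theorem smoothIndicator_eq (hL : 0 < L) (x : E3) :
    smoothIndicator η L q k x =
      ∫ z, (periodicCube L q k).indicator (fun _ => (1 : ℝ))
        (x - (waveNumber L q)⁻¹ • z) * η z := by
  have hr := waveNumber_pos hL q
  have h := Measure.integral_comp_smul (volume : Measure E3)
    (fun z => (periodicCube L q k).indicator (fun _ => (1 : ℝ))
        (x - (waveNumber L q)⁻¹ • z) * η z) (waveNumber L q)
  simp only [smul_smul, inv_mul_cancel₀ hr.ne', one_smul, finrank_euclideanSpace,
    Fintype.card_fin] at h
  have e : ∀ y, (periodicCube L q k).indicator (fun _ => (1 : ℝ)) (x - y) *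
      (2 ^ (3 * q) * η (waveNumber L q • y)) = 2 ^ (3 * q) *
      ((periodicCube L q k).indicator (fun _ => (1 : ℝ)) (x - y) * η (waveNumber L q • y)) :=
    fun y => by ring
  simp_rw [smoothIndicator, e]
  rw [integral_const_mul, h, smul_eq_mul, ← mul_assoc, ← mul_assoc]
  rw [abs_of_pos (by positivity)]
  have : (L ^ 3)⁻¹ * 2 ^ (3 * q) * (waveNumber L q ^ 3)⁻¹ = 1 := by
    rw [waveNumber, div_pow, ← pow_mul, mul_comm q]
    field_simp
  rw [this, one_mul]

/-- In rescaled variables the kernel is the fixed `η`, which makes the derivative bounds uniform in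
`L`, `q` and `k` up to powers of `λ_q`. -/
theorem smoothIndicator_eq_convolution (hL : 0 < L) :
    smoothIndicator η L q k = fun x =>
      convolution (fun w => (periodicCube L q k).indicator (fun _ => (1 : ℝ))
        ((waveNumber L q)⁻¹ • w)) η (ContinuousLinearMap.lsmul ℝ ℝ) volume
        (waveNumber L q • x) := by
  ext x
  have hr := waveNumber_pos hL q
  rw [smoothIndicator_eq hL, convolution_def, ← integral_sub_left_eq_self _ volume
    (waveNumber L q • x)]
  refine integral_congr_ae (Eventually.of_forall fun z => ?_)
  simp [smul_sub, smul_smul, inv_mul_cancel₀ hr.ne']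

theorem measurable_indicator_periodicCube :
    Measurable fun w : E3 => (periodicCube L q k).indicator (fun _ => (1 : ℝ))
        ((waveNumber L q)⁻¹ • w) :=
  (measurable_const.indicator (measurableSet_periodicCube L q k)).comp (by fun_prop)

theorem norm_indicator_periodicCube_le (w : E3) :
    ‖(periodicCube L q k).indicator (fun _ => (1 : ℝ)) w‖ ≤ 1 := by
  by_cases h : w ∈ periodicCube L q k <;> simp [h]

theorem contDiff_convolution_indicator (hη : IsMollifier η) :
    ContDiff ℝ ∞ (convolution (fun w => (periodicCube L q k).indicator (fun _ => (1 : ℝ))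
        ((waveNumber L q)⁻¹ • w)) η (ContinuousLinearMap.lsmul ℝ ℝ) volume) :=
  hη.hasCompactSupport.contDiff_convolution_right (n := ⊤) _
    (locallyIntegrable_of_bounded measurable_indicator_periodicCube
      fun _ => norm_indicator_periodicCube_le _) hη.smooth

theorem contDiff_smoothIndicator (hη : IsMollifier η) (hL : 0 < L) :
    ContDiff ℝ ∞ (smoothIndicator η L q k) := by
  rw [smoothIndicator_eq_convolution hL]
  exact (contDiff_convolution_indicator hη).comp (contDiff_const_smul _)

theorem norm_iteratedFDeriv_smoothIndicator_le (hη : IsMollifier η) (hL : 0 < L) (n : ℕ) (x : E3) :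
    ‖iteratedFDeriv ℝ n (smoothIndicator η L q k) x‖ ≤
      (∫ y, ‖iteratedFDeriv ℝ n η y‖) * waveNumber L q ^ n := by
  have hr := waveNumber_pos hL q
  rw [smoothIndicator_eq_convolution hL, iteratedFDeriv_comp_const_smul _
    ((contDiff_convolution_indicator hη).of_le (by exact_mod_cast le_top)), norm_smul, norm_pow,
    Real.norm_of_nonneg hr.le, mul_comm]
  gcongr
  exact norm_iteratedFDeriv_convolution_le measurable_indicator_periodicCube
    (fun _ => norm_indicator_periodicCube_le _) n hη.smooth hη.hasCompactSupport _

theorem exists_of_smoothIndicator_ne_zero (hη : IsMollifier η) (hL : 0 < L) {x : E3}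
    (hx : smoothIndicator η L q k x ≠ 0) :
    ∃ z : E3, ‖z‖ ≤ 1 ∧ x - (waveNumber L q)⁻¹ • z ∈ periodicCube L q k := by
  by_contra! hcon
  apply hx
  rw [smoothIndicator_eq hL]
  refine integral_eq_zero_of_ae (Eventually.of_forall fun z => ?_)
  by_cases hz : ‖z‖ ≤ 1
  · simp [hcon z hz]
  · have : η z = 0 := by
      by_contra h
      exact hz (by simpa using hη.supp (subset_tsupport η h))
    simp [this]

theorem sum_smoothIndicator (hη : IsMollifier η) (hL : 0 < L) (x : E3) :
    ∑ k, smoothIndicator η L q k x = 1 := by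
  simp_rw [smoothIndicator_eq hL]
  rw [← integral_finsetSum]
  · refine Eq.trans ?_ hη.integral_eq_one
    refine integral_congr_ae (Eventually.of_forall fun z => ?_)
    have h : ∀ y : E3, ∑ k, (periodicCube L q k).indicator (fun _ => (1 : ℝ)) y = 1 := fun y => by
      classical
      simp only [Set.indicator_apply, mem_periodicCube_iff hL, Finset.sum_ite_eq, Finset.mem_univ,
        if_true]
    beta_reduce
    rw [← Finset.sum_mul, h, one_mul]
  · intro k _
    refine (hη.smooth.continuous.integrable_of_hasCompactSupport
      hη.hasCompactSupport).bdd_mul (c := 1) ?_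
      (Eventually.of_forall fun _ => norm_indicator_periodicCube_le _)
    exact ((measurable_const.indicator (measurableSet_periodicCube L q k)).comp
      (by fun_prop)).aestronglyMeasurable

theorem abs_floor_sub_floor_le {a b : ℝ} (h : |b| ≤ 1) : |⌊a⌋ - ⌊a - b⌋| ≤ 1 := by
  have h1 := Int.floor_le a
  have h2 := Int.lt_floor_add_one a
  have h3 := Int.floor_le (a - b)
  have h4 := Int.lt_floor_add_one (a - b)
  obtain ⟨h5, h6⟩ := abs_le.1 h
  rw [abs_le]
  constructor
  · have : (-2 : ℝ) < ⌊a⌋ - ⌊a - b⌋ := by linarith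
    have : (-2 : ℤ) < ⌊a⌋ - ⌊a - b⌋ := by exact_mod_cast this
    omega
  · have : (⌊a⌋ - ⌊a - b⌋ : ℝ) < 2 := by linarith
    have : ⌊a⌋ - ⌊a - b⌋ < (2 : ℤ) := by exact_mod_cast this
    omega

theorem abs_floorIndex_sub_le (hL : 0 < L) (x : E3) {z : E3} (hz : ‖z‖ ≤ 1) (i : Fin 3) :
    |floorIndex L q x i - floorIndex L q (x - (waveNumber L q)⁻¹ • z) i| ≤ 1 := by
  have hl := lengthScale_pos hL q
  have : (x - (waveNumber L q)⁻¹ • z) i / lengthScale L q = x i / lengthScale L q - z i := by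
    rw [inv_waveNumber, PiLp.sub_apply, PiLp.smul_apply, smul_eq_mul, sub_div,
      mul_div_cancel_left₀ _ hl.ne']
  rw [floorIndex, floorIndex, this]
  exact abs_floor_sub_floor_le ((PiLp.norm_apply_le z i).trans hz)

/-- The indices of the cubes adjacent to the cube that contains `x`. -/
noncomputable def adjacentIndices (L : ℝ) (q : ℕ) (x : E3) : Finset (Fin 3 → Fin (2 ^ q)) :=
  (Fintype.piFinset fun _ : Fin 3 => Finset.Icc (-1 : ℤ) 1).image
    fun e => reduce q fun i => floorIndex L q x i - e i

theorem card_adjacentIndices_le (x : E3) : (adjacentIndices L q x).card ≤ 27 := by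
  refine Finset.card_image_le.trans ?_
  simp [Fintype.card_piFinset]

theorem mem_adjacentIndices (hL : 0 < L) {x z : E3} (hz : ‖z‖ ≤ 1)
    (h : x - (waveNumber L q)⁻¹ • z ∈ periodicCube L q k) : k ∈ adjacentIndices L q x := by
  rw [mem_periodicCube_iff hL] at h
  refine Finset.mem_image.2 ⟨fun i => floorIndex L q x i -
    floorIndex L q (x - (waveNumber L q)⁻¹ • z) i, ?_, ?_⟩
  · simp only [Fintype.mem_piFinset, Finset.mem_Icc]
    exact fun i => abs_le.1 (abs_floorIndex_sub_le hL x hz i)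
  · simpa using h

theorem mem_dilatedCube_of_mem_adjacentIndices (hL : 0 < L) {x : E3} (hx : x ∈ box L)
    (h : k ∈ adjacentIndices L q x) : x ∈ dilatedCube L q k := by
  obtain ⟨e, he, rfl⟩ := Finset.mem_image.1 h
  simp only [Fintype.mem_piFinset, Finset.mem_Icc] at he
  refine Set.mem_iUnion₂.2 ⟨_, ?_, mem_cube_reduce hL q hx⟩
  -- The difference of the quotients undoes both reductions modulo `2^q`, leaving the offset `e`,
  -- with `|e|² ≤ 3 < 9`.
  refine ⟨fun i => floorIndex L q x i / 2 ^ q - (floorIndex L q x i - e i) / 2 ^ q, ?_⟩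
  have h1 : ∀ i, ((reduce q (floorIndex L q x) i : ℕ) : ℤ) -
      ((reduce q (fun i => floorIndex L q x i - e i) i : ℕ) : ℤ) +
      2 ^ q * (floorIndex L q x i / 2 ^ q - (floorIndex L q x i - e i) / 2 ^ q) = e i := by
    intro i
    rw [reduce_coe, reduce_coe]
    have h2 := Int.emod_add_mul_ediv (floorIndex L q x i) (2 ^ q)
    have h3 := Int.emod_add_mul_ediv (floorIndex L q x i - e i) (2 ^ q)
    linarith
  simp only [h1]
  have h4 : ∀ i, e i ^ 2 ≤ 1 := fun i => by nlinarith [he i]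
  calc ∑ i, e i ^ 2 ≤ ∑ _i : Fin 3, (1 : ℤ) := Finset.sum_le_sum fun i _ => h4 i
    _ < 3 ^ 2 := by simp

/-- The mollifier displaces by at most `ℓ_q`. Indices at distance less than `3` differ by at most
`2` in each coordinate, modulo `2^q`, so points of the two cubes differ by at most `3 ℓ_q` per
coordinate, hence by less than `6 ℓ_q` in norm. -/
theorem exists_norm_add_period_sub_le (hL : 0 < L) {x y z : E3} (hx : x ∈ dilatedCube L q k)
    (hz : ‖z‖ ≤ 1) (h : y - (waveNumber L q)⁻¹ • z ∈ periodicCube L q k) :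
    ∃ n, ‖y + period L n - x‖ ≤ 7 * lengthScale L q := by
  have hl := lengthScale_pos hL q
  obtain ⟨k', ⟨m, hm⟩, hxk⟩ := Set.mem_iUnion₂.1 hx
  obtain ⟨n, hn⟩ : ∃ n, y - (waveNumber L q)⁻¹ • z + period L n ∈ cube L q k := h
  rw [inv_waveNumber] at hn
  set p := y - lengthScale L q • z + period L n with hp
  refine ⟨n - m, ?_⟩
  have h1 : y + period L (n - m) - x = lengthScale L q • z + (p - x - period L m) := by
    ext i
    simp [hp]
    ring
  have h2 : ∀ i, |(p - x - period L m) i| ≤ 3 * lengthScale L q := by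
    intro i
    have h3 : (((k' i : ℕ) : ℤ) - ((k i : ℕ) : ℤ) + 2 ^ q * m i) ^ 2 < 3 ^ 2 :=
      lt_of_le_of_lt (Finset.single_le_sum (f := fun i =>
        (((k' i : ℕ) : ℤ) - ((k i : ℕ) : ℤ) + 2 ^ q * m i) ^ 2) (fun j _ => sq_nonneg _)
        (Finset.mem_univ i)) hm
    have h4 := abs_lt.1 (abs_lt_of_sq_lt_sq h3 (by norm_num))
    have h5 : (-2 : ℝ) ≤ ((k' i : ℕ) : ℝ) - ((k i : ℕ) : ℝ) + 2 ^ q * m i := by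
      have : (-2 : ℤ) ≤ ((k' i : ℕ) : ℤ) - ((k i : ℕ) : ℤ) + 2 ^ q * m i := by omega
      exact_mod_cast this
    have h6 : ((k' i : ℕ) : ℝ) - ((k i : ℕ) : ℝ) + 2 ^ q * m i ≤ 2 := by
      have : ((k' i : ℕ) : ℤ) - ((k i : ℕ) : ℤ) + 2 ^ q * m i ≤ (2 : ℤ) := by omega
      exact_mod_cast this
    have h7 : (p - x - period L m) i = p i - x i - lengthScale L q * (2 ^ q * m i) := by
      rw [PiLp.sub_apply, PiLp.sub_apply, period_apply, ← mul_assoc, lengthScale_mul_pow]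
    obtain ⟨a1, a2⟩ := hn i
    obtain ⟨b1, b2⟩ := hxk i
    rw [h7, abs_le]
    constructor <;> nlinarith
  have h3 : ‖p - x - period L m‖ ≤ 6 * lengthScale L q := by
    rw [EuclideanSpace.norm_eq]
    refine Real.sqrt_le_iff.2 ⟨by positivity, ?_⟩
    calc _ ≤ ∑ _i : Fin 3, (3 * lengthScale L q) ^ 2 := by
          gcongr with i
          exact h2 i
      _ ≤ _ := by simp; nlinarith
  rw [h1]
  calc _ ≤ ‖lengthScale L q • z‖ + ‖p - x - period L m‖ := norm_add_le _ _
    _ ≤ lengthScale L q * 1 + 6 * lengthScale L q := by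
        rw [norm_smul, Real.norm_of_nonneg hl.le]
        gcongr
    _ = _ := by ring

end SmoothIndicator

end Intermittency

namespace Intermittency

/-! ### Littlewood-Paley pieces as trigonometric polynomials -/

section Piece

variable {χ η : E3 → ℝ} {L : ℝ} {q : ℕ} {v : E3 → E3}

/-- The finite set of lattice points that carries the multiplier of index `q`. -/
noncomputable def frequencies (q : ℕ) : Finset (Fin 3 → ℤ) :=
  open scoped Classical in
  (Fintype.piFinset fun _ => Finset.Icc (-2 ^ (q + 1)) (2 ^ (q + 1))).filter
    fun m => ‖latticePoint (2 ^ q) m‖ ≤ 2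

theorem mem_frequencies {m : Fin 3 → ℤ} : m ∈ frequencies q ↔ ‖latticePoint (2 ^ q) m‖ ≤ 2 := by
  simp only [frequencies, Finset.mem_filter, and_iff_right_iff_imp, Fintype.mem_piFinset,
    Finset.mem_Icc]
  intro h i
  have h1 := (PiLp.norm_apply_le (latticePoint (2 ^ q) m) i).trans h
  rw [latticePoint, Real.norm_eq_abs] at h1
  change |(m i : ℝ) / 2 ^ q| ≤ 2 at h1
  rw [abs_div, abs_of_pos (by positivity : (0 : ℝ) < 2 ^ q), div_le_iff₀ (by positivity)] at h1
  have h2 : |m i| ≤ 2 ^ (q + 1) := by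
    rw [pow_succ, mul_comm]; exact_mod_cast h1
  exact abs_le.1 h2

theorem smul_latticePoint (hL : 0 < L) (m : Fin 3 → ℤ) :
    (L / 2 ^ q) • latticePoint L m = latticePoint (2 ^ q) m := by
  ext i
  simp only [latticePoint, PiLp.smul_apply, smul_eq_mul]
  field_simp

theorem latticePoint_eq (hL : 0 < L) (q : ℕ) (m : Fin 3 → ℤ) :
    latticePoint L m = waveNumber L q • latticePoint (2 ^ q) m := by
  ext i
  simp only [latticePoint, waveNumber, PiLp.smul_apply, smul_eq_mul]
  field_simp

theorem IsCutoff.eq_zero (hχ : IsCutoff χ) {ξ : E3} (h : 1 ≤ ‖ξ‖) : χ ξ = 0 := by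
  by_contra h0
  have := hχ.supp (subset_tsupport χ h0)
  rw [mem_ball_zero_iff] at this
  linarith

/-- Both terms of `φ` vanish outside the ball of radius `2`, the ball on which the reproducing
kernel has transform `1`. -/
theorem multiplier_eq_zero (hχ : IsCutoff χ) (hL : 0 < L) {m : Fin 3 → ℤ}
    (hm : m ∉ frequencies q) : multiplier χ L q (latticePoint L m) = 0 := by
  rw [mem_frequencies, not_le] at hm
  rw [multiplier, smul_latticePoint hL, hχ.eq_zero, hχ.eq_zero, sub_self]
  · linarith
  · rw [norm_smul]; norm_num; linarith

/-- The Fourier coefficients of the piece of index `q`. -/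
noncomputable def pieceCoeff (χ : E3 → ℝ) (L : ℝ) (v : E3 → E3) (q : ℕ) (m : Fin 3 → ℤ) : C3 :=
  (multiplier χ L q (latticePoint L m) : ℂ) • fourierCoeffBox L v (latticePoint L m)

theorem piece_eq_sum (hχ : IsCutoff χ) (hL : 0 < L) (v : E3 → E3) (q : ℕ) (x : E3) :
    piece χ L v q x = ∑ m ∈ frequencies q, wave (latticePoint L m) x • pieceCoeff χ L v q m := by
  rw [piece, tsum_eq_sum (s := frequencies q)]
  · refine Finset.sum_congr rfl fun m _ => ?_
    rw [pieceCoeff, smul_smul, mul_comm]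
    rfl
  · intro m hm
    rw [multiplier_eq_zero hχ hL hm]
    simp

theorem piece_eq_trigPoly (hχ : IsCutoff χ) (hL : 0 < L) (v : E3 → E3) (q : ℕ) :
    piece χ L v q = trigPoly (frequencies q) (fun m => waveNumber L q • latticePoint (2 ^ q) m)
      (pieceCoeff χ L v q) := by
  ext1 x
  rw [piece_eq_sum hχ hL]
  refine Finset.sum_congr rfl fun m _ => ?_
  rw [latticePoint_eq hL q]

theorem contDiff_piece (hχ : IsCutoff χ) (hL : 0 < L) : ContDiff ℝ ∞ (piece χ L v q) := by
  rw [piece_eq_trigPoly hχ hL]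
  exact contDiff_trigPoly

theorem wave_add_period (hL : 0 < L) (m : Fin 3 → ℤ) (x : E3) (n : Fin 3 → ℤ) :
    wave (latticePoint L m) (x + period L n) = wave (latticePoint L m) x := by
  have h : inner ℝ (latticePoint L m) (period L n) = ((∑ i, m i * n i : ℤ) : ℝ) := by
    simp only [PiLp.inner_apply, latticePoint, period]
    push_cast
    refine Finset.sum_congr rfl fun i _ => ?_
    simp
    field_simp
  rw [wave_add]
  have : wave (latticePoint L m) (period L n) = 1 := by
    rw [wave, h]
    have := Complex.exp_int_mul_two_pi_mul_I (∑ i, m i * n i)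
    rw [← this]
    congr 1
    push_cast; ring
  rw [this, mul_one]

theorem piece_add_period (hχ : IsCutoff χ) (hL : 0 < L) (x : E3) (n : Fin 3 → ℤ) :
    piece χ L v q (x + period L n) = piece χ L v q x := by
  simp only [piece_eq_sum hχ hL, wave_add_period hL]

theorem smear_add_period {r : ℝ} {F : E3 → C3} (hF : ∀ x n, F (x + period L n) = F x)
    (x : E3) (n : Fin 3 → ℤ) : smear r F (x + period L n) = smear r F x := by
  refine lintegral_congr fun z => ?_
  rw [add_sub_right_comm, hF]

/-! ### Activity of cubes and size of the piece -/

/-- Leibniz' rule: each derivative costs a factor `λ_q`, whether it falls on the mollified indicator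
or, by Bernstein's inequality, on the piece. -/
theorem exists_norm_iteratedFDeriv_localPiece_le (hχ : IsCutoff χ) (hη : IsMollifier η) (n : ℕ) :
    ∃ C : ℝ, 0 ≤ C ∧ ∀ (L : ℝ), 0 < L → ∀ (v : E3 → E3) (q : ℕ) (k : Fin 3 → Fin (2 ^ q)) (y : E3),
      ‖iteratedFDeriv ℝ n (localPiece χ η L v q k) y‖ₑ ≤
        ENNReal.ofReal (C * waveNumber L q ^ n) *
          smear (waveNumber L q) (piece χ L v q) y := by
  choose B hB0 hB using exists_enorm_iteratedFDeriv_trigPoly_le hχ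
  have hI : ∀ i, 0 ≤ ∫ y, ‖iteratedFDeriv ℝ i η y‖ := fun i =>
    integral_nonneg fun _ => norm_nonneg _
  have hI' := fun i => mul_nonneg (hI i) (hB0 (n - i))
  refine ⟨∑ i ∈ Finset.range (n + 1), (n.choose i : ℝ) *
    ((∫ y, ‖iteratedFDeriv ℝ i η y‖) * B (n - i)), Finset.sum_nonneg fun i _ =>
      mul_nonneg (Nat.cast_nonneg _) (hI' i), fun L hL v q k y => ?_⟩
  have hr := waveNumber_pos hL q
  set r := waveNumber L q
  set F := piece χ L v q with hF
  have hfin : smear r F y ≠ ⊤ := by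
    rw [hF, piece_eq_trigPoly hχ hL]; exact smear_trigPoly_ne_top _ _
  have hD : ∀ j, ‖iteratedFDeriv ℝ j F y‖ ≤ B j * r ^ j * (smear r F y).toReal := fun j => by
    have h := hB j _ (frequencies q) (pieceCoeff χ L v q) (fun m => latticePoint (2 ^ q) m)
      (fun m hm => mem_frequencies.1 hm) r hr y
    rw [← piece_eq_trigPoly hχ hL] at h
    have h2 := ENNReal.toReal_mono (ENNReal.mul_ne_top ENNReal.ofReal_ne_top hfin) h
    rwa [toReal_enorm, ENNReal.toReal_mul,
      ENNReal.toReal_ofReal (mul_nonneg (hB0 j) (pow_nonneg hr.le j))] at h2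
  have h1 := norm_iteratedFDeriv_smul_le (contDiff_smoothIndicator (k := k) hη hL)
    (contDiff_piece (v := v) (q := q) hχ hL) y (n := n) (by exact_mod_cast le_top)
  have h2 : ‖iteratedFDeriv ℝ n (localPiece χ η L v q k) y‖ ≤
      (∑ i ∈ Finset.range (n + 1), (n.choose i : ℝ) *
        ((∫ y, ‖iteratedFDeriv ℝ i η y‖) * B (n - i))) * r ^ n * (smear r F y).toReal := by
    refine h1.trans ?_
    rw [Finset.sum_mul, Finset.sum_mul]
    refine Finset.sum_le_sum fun i hi => ?_
    have hin : i ≤ n := Nat.lt_succ_iff.1 (Finset.mem_range.1 hi)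
    calc _ ≤ (n.choose i : ℝ) * ((∫ y, ‖iteratedFDeriv ℝ i η y‖) * r ^ i) *
          (B (n - i) * r ^ (n - i) * (smear r F y).toReal) := by
          have := hI i
          gcongr
          · exact norm_iteratedFDeriv_smoothIndicator_le hη hL i y
          · exact hD _
      _ = _ := by
          rw [← Nat.add_sub_of_le hin, pow_add, Nat.add_sub_of_le hin]; ring
  rw [← ofReal_norm]
  refine (ENNReal.ofReal_le_ofReal h2).trans ?_
  rw [ENNReal.ofReal_mul (mul_nonneg (Finset.sum_nonneg fun i _ =>
      mul_nonneg (Nat.cast_nonneg _) (hI' i)) (pow_nonneg hr.le n)), ENNReal.ofReal_toReal hfin]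

/-- The piece is large in the smeared sense on the dilates of the active cubes. -/
theorem exists_lt_smear_of_lt_atomicCoeff (hχ : IsCutoff χ) (hη : IsMollifier η) (M : ℕ) :
    ∃ C : ℝ, 0 ≤ C ∧ ∀ (L : ℝ), 0 < L → ∀ (v : E3 → E3) (q : ℕ) (k : Fin 3 → Fin (2 ^ q))
      (θ : ℝ≥0∞) (x : E3), x ∈ dilatedCube L q k → θ < atomicCoeff χ η M L v q k →
        θ < ENNReal.ofReal C * smear (waveNumber L q) (piece χ L v q) x := by
  choose B hB0 hB using fun n => exists_norm_iteratedFDeriv_localPiece_le hχ hη n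
  refine ⟨(∑ n ∈ Finset.range (M + 1), B n) * (1 + 8) ^ 4,
    mul_nonneg (Finset.sum_nonneg fun n _ => hB0 n) (by norm_num),
    fun L hL v q k θ x hx hθ => ?_⟩
  have hr := waveNumber_pos hL q
  have hl := lengthScale_pos hL q
  rw [atomicCoeff] at hθ
  simp only [lt_iSup_iff] at hθ
  obtain ⟨n, hn, e, y, hy⟩ := hθ
  have hy0 : iteratedFDeriv ℝ n (localPiece χ η L v q k) y ≠ 0 := fun h => by
    rw [h] at hy
    simp at hy
  have hy1 := support_iteratedFDeriv_subset (𝕜 := ℝ) n (Function.mem_support.2 hy0)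
  -- A nonzero derivative only places `y` in the closed support of `b_qk`. A point `y'` within `ℓ_q`
  -- where `b_qk` itself is nonzero raises the constant from `7` to `8`.
  obtain ⟨y', hy', hd⟩ := Metric.mem_closure_iff.1 hy1 _ hl
  have hs : smoothIndicator η L q k y' ≠ 0 := fun h => hy' (by rw [localPiece, h, zero_smul])
  obtain ⟨z, hz, hzk⟩ := exists_of_smoothIndicator_ne_zero hη hL hs
  obtain ⟨p, hp⟩ := exists_norm_add_period_sub_le hL hx hz hzk
  have hclose : waveNumber L q * ‖y + period L p - x‖ ≤ 8 := by
    have : ‖y + period L p - x‖ ≤ 8 * lengthScale L q := by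
      have h1 : y + period L p - x = (y - y') + (y' + period L p - x) := by
        ext i
        simp only [PiLp.add_apply, PiLp.sub_apply]
        ring
      rw [h1]
      refine (norm_add_le _ _).trans ?_
      rw [dist_eq_norm] at hd
      linarith
    rw [← inv_waveNumber, ← div_eq_mul_inv, le_div_iff₀ hr] at this
    linarith
  have hper : ∀ x n, piece χ L v q (x + period L n) = piece χ L v q x := piece_add_period hχ hL
  have hsm : smear (waveNumber L q) (piece χ L v q) y ≤
      ENNReal.ofReal ((1 + 8) ^ 4) * smear (waveNumber L q) (piece χ L v q) x := by
    rw [← smear_add_period hper y p]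
    exact smear_le hr (contDiff_piece hχ hL).continuous hclose
  refine hy.trans_le ?_
  have h3 : ‖iteratedFDeriv ℝ n (localPiece χ η L v q k) y
      (fun j => EuclideanSpace.single (e j) (1 : ℝ))‖ₑ ≤
      ‖iteratedFDeriv ℝ n (localPiece χ η L v q k) y‖ₑ := by
    rw [enorm_le_iff_norm_le]
    refine (ContinuousMultilinearMap.le_opNorm _ _).trans ?_
    simp
  calc _ ≤ ENNReal.ofReal ((waveNumber L q)⁻¹ ^ n) *
        (ENNReal.ofReal (B n * waveNumber L q ^ n) * (ENNReal.ofReal ((1 + 8) ^ 4) *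
          smear (waveNumber L q) (piece χ L v q) x)) := by
        gcongr
        exact h3.trans ((hB n L hL v q k y).trans (mul_le_mul_right hsm _))
    _ = ENNReal.ofReal (B n * (1 + 8) ^ 4) * smear (waveNumber L q) (piece χ L v q) x := by
        rw [← mul_assoc, ← mul_assoc, ← ENNReal.ofReal_mul (by positivity),
          ← ENNReal.ofReal_mul (mul_nonneg (by positivity)
            (mul_nonneg (hB0 n) (pow_nonneg hr.le n)))]
        congr 2
        rw [inv_pow]
        field_simp
    _ ≤ _ := by
        gcongr
        exact Finset.single_le_sum (fun n _ => hB0 n) (Finset.mem_range.2 (by omega))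

theorem enorm_localPiece_le_atomicCoeff (M : ℕ) (k : Fin 3 → Fin (2 ^ q)) (x : E3) :
    ‖localPiece χ η L v q k x‖ₑ ≤ atomicCoeff χ η M L v q k := by
  have h : ‖localPiece χ η L v q k x‖ₑ = ENNReal.ofReal ((waveNumber L q)⁻¹ ^ 0) *
      ‖iteratedFDeriv ℝ 0 (localPiece χ η L v q k) x
        (fun j => EuclideanSpace.single (Fin.elim0 j) (1 : ℝ))‖ₑ := by simp
  rw [h, atomicCoeff]
  exact le_iSup₂_of_le 0 (Nat.zero_le M) (le_iSup₂_of_le Fin.elim0 x le_rfl)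

theorem enorm_sum_C3_le {ι : Type} (S : Finset ι) (f : ι → C3) :
    ‖∑ k ∈ S, f k‖ₑ ≤ ∑ k ∈ S, ‖f k‖ₑ := by
  have h : ‖∑ k ∈ S, f k‖₊ ≤ ∑ k ∈ S, ‖f k‖₊ := nnnorm_sum_le S f
  simp only [enorm_eq_nnnorm]
  exact_mod_cast h

/-- The piece is small outside of the dilates of the active cubes. -/
theorem enorm_piece_le_of_forall_notMem (hη : IsMollifier η) (hL : 0 < L) {M : ℕ} {θ : ℝ≥0∞}
    {x : E3} (hx : x ∈ box L)
    (h : ∀ k, θ < atomicCoeff χ η M L v q k → x ∉ dilatedCube L q k) :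
    ‖piece χ L v q x‖ₑ ≤ 27 * θ := by
  -- Partition of unity: only the cubes adjacent to `x` contribute. As `x` lies in all their
  -- dilates, none of them is active.
  have h1 : piece χ L v q x = ∑ k ∈ adjacentIndices L q x, localPiece χ η L v q k x := by
    rw [Finset.sum_subset (Finset.subset_univ _)]
    · simp_rw [localPiece]
      rw [← Finset.sum_smul, sum_smoothIndicator hη hL, one_smul]
    · intro k _ hk
      by_contra h0
      have hs : smoothIndicator η L q k x ≠ 0 := fun h => h0 (by rw [localPiece, h, zero_smul])
      obtain ⟨z, hz, hzk⟩ := exists_of_smoothIndicator_ne_zero hη hL hs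
      exact hk (mem_adjacentIndices hL hz hzk)
  have h2 : ∀ k ∈ adjacentIndices L q x, ‖localPiece χ η L v q k x‖ₑ ≤ θ := fun k hk => by
    by_contra hlt
    rw [not_le] at hlt
    exact h k (hlt.trans_le (enorm_localPiece_le_atomicCoeff M k x))
      (mem_dilatedCube_of_mem_adjacentIndices hL hx hk)
  have h3 : ((adjacentIndices L q x).card : ℝ≥0∞) ≤ 27 := by
    exact_mod_cast card_adjacentIndices_le x
  rw [h1]
  refine (enorm_sum_C3_le _ _).trans ((Finset.sum_le_sum h2).trans ?_)
  rw [Finset.sum_const, nsmul_eq_mul]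
  exact mul_le_mul_left h3 θ

end Piece

end Intermittency

namespace Intermittency

section SpaceTime

variable {χ η : E3 → ℝ} {L T : ℝ} {u : ℝ → E3 → E3} {σ : ℕ → ℝ} {M : ℕ}

/-! ### Space-time measurability and integrability of the pieces -/

theorem volume_restrict_spaceTime (L T : ℝ) :
    (volume : Measure (ℝ × E3)).restrict (spaceTime L T) =
      (volume.restrict (Icc 0 T)).prod (volume.restrict (box L)) := by
  rw [spaceTime, Measure.volume_eq_prod, Measure.prod_restrict]

theorem measurableSet_spaceTime (L T : ℝ) : MeasurableSet (spaceTime L T) :=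
  measurableSet_Icc.prod (measurableSet_box L)

theorem volume_spaceTime (hL : 0 < L) (hT : 0 < T) :
    volume (spaceTime L T) = ENNReal.ofReal (T * L ^ 3) := by
  rw [spaceTime, Measure.volume_eq_prod, Measure.prod_prod, Real.volume_Icc, volume_box hL,
    ← ENNReal.ofReal_mul (by simpa using hT.le), sub_zero]

theorem measurable_fourierCoeffBox {g : ℝ × E3 → E3} (hg : StronglyMeasurable g) (k : E3) :
    Measurable fun t => fourierCoeffBox L (fun x => g (t, x)) k := by
  refine (WithLp.measurable_toLp 2 _).comp (measurable_pi_lambda _ fun i => ?_)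
  refine Measurable.const_mul ?_ _
  have h : StronglyMeasurable fun z : ℝ × E3 =>
      Complex.exp (-(2 * Real.pi * (inner ℝ k z.2 : ℝ) * Complex.I)) * (g z i : ℂ) := by
    refine Measurable.stronglyMeasurable ?_
    have := hg.measurable
    fun_prop
  exact (h.integral_prod_right (ν := volume.restrict (box L))).measurable

theorem measurable_piece (hχ : IsCutoff χ) (hL : 0 < L) {g : ℝ × E3 → E3}
    (hg : StronglyMeasurable g) (q : ℕ) :
    Measurable fun z : ℝ × E3 => piece χ L (fun x => g (z.1, x)) q z.2 := by
  simp only [piece_eq_sum hχ hL]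
  refine Finset.measurable_sum _ fun m _ => ?_
  have h1 : Measurable fun z : ℝ × E3 => wave (latticePoint L m) z.2 :=
    (contDiff_wave _).continuous.measurable.comp measurable_snd
  have h2 : Measurable fun z : ℝ × E3 => pieceCoeff χ L (fun x => g (z.1, x)) q m :=
    Measurable.const_smul (g := fun z : ℝ × E3 => fourierCoeffBox L (fun x => g (z.1, x))
      (latticePoint L m)) ((measurable_fourierCoeffBox hg _).comp measurable_fst)
      (multiplier χ L q (latticePoint L m) : ℂ)
  exact h1.smul h2

/-- Almost every time slice of the pieces agrees with that of jointly measurable ones. -/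
theorem exists_measurable_piece (hχ : IsCutoff χ) (hL : 0 < L)
    (hu : AEStronglyMeasurable (fun z : ℝ × E3 => u z.1 z.2)
      (volume.restrict (spaceTime L T))) :
    ∃ g : ℝ → E3 → E3, (∀ q, Measurable fun z : ℝ × E3 => piece χ L (g z.1) q z.2) ∧
      ∀ᵐ t ∂volume.restrict (Icc 0 T), ∀ q, piece χ L (u t) q = piece χ L (g t) q := by
  obtain ⟨G, hG, h⟩ := hu
  refine ⟨fun t x => G (t, x), fun q => measurable_piece hχ hL hG q, ?_⟩
  rw [volume_restrict_spaceTime] at h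
  filter_upwards [Measure.ae_ae_of_ae_prod h] with t ht q
  ext1 x
  -- The pieces see a slice only through Fourier integrals, so slices that agree almost everywhere
  -- have pieces that agree at every point.
  have : ∀ k, fourierCoeffBox L (u t) k = fourierCoeffBox L (fun x => G (t, x)) k := by
    intro k
    unfold fourierCoeffBox
    congr 1
    ext1 i
    congr 1
    refine integral_congr_ae ?_
    filter_upwards [ht] with y hy
    rw [hy]
  simp only [piece, this]

theorem aemeasurable_piece (hχ : IsCutoff χ) (hL : 0 < L)
    (hu : AEStronglyMeasurable (fun z : ℝ × E3 => u z.1 z.2)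
      (volume.restrict (spaceTime L T))) (q : ℕ) :
    AEMeasurable (fun z : ℝ × E3 => piece χ L (u z.1) q z.2)
      (volume.restrict (spaceTime L T)) := by
  obtain ⟨g, hg, hug⟩ := exists_measurable_piece (χ := χ) hχ hL hu
  refine ⟨_, hg q, ?_⟩
  rw [volume_restrict_spaceTime]
  filter_upwards [Measure.quasiMeasurePreserving_fst.ae hug] with z hz
  rw [hz q]

theorem norm_le_sum_norm (x : C3) : ‖x‖ ≤ ∑ i, ‖x i‖ := by
  rw [EuclideanSpace.norm_eq]
  refine Real.sqrt_le_iff.2 ⟨Finset.sum_nonneg fun _ _ => norm_nonneg _, ?_⟩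
  simp only [Fin.sum_univ_three]
  nlinarith [norm_nonneg (x 0), norm_nonneg (x 1), norm_nonneg (x 2),
    mul_nonneg (norm_nonneg (x 0)) (norm_nonneg (x 1)),
    mul_nonneg (norm_nonneg (x 0)) (norm_nonneg (x 2)),
    mul_nonneg (norm_nonneg (x 1)) (norm_nonneg (x 2))]

theorem enorm_fourierCoeffBox_le (hL : 0 < L) (v : E3 → E3) (k : E3) :
    ‖fourierCoeffBox L v k‖ₑ ≤ ENNReal.ofReal (3 * (L ^ 3)⁻¹) * ∫⁻ x in box L, ‖v x‖ₑ := by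
  have h1 : ∀ i, ‖fourierCoeffBox L v k i‖ₑ ≤
      ENNReal.ofReal (L ^ 3)⁻¹ * ∫⁻ x in box L, ‖v x‖ₑ := by
    intro i
    rw [fourierCoeffBox]
    change ‖((L ^ 3 : ℝ) : ℂ)⁻¹ * _‖ₑ ≤ _
    rw [enorm_mul]
    gcongr
    · rw [← ofReal_norm, norm_inv, Complex.norm_real, Real.norm_of_nonneg (by positivity)]
    · refine (enorm_integral_le_lintegral_enorm _).trans (lintegral_mono fun x => ?_)
      rw [enorm_mul]
      have e : ‖Complex.exp (-(2 * Real.pi * (inner ℝ k x : ℝ) * Complex.I))‖ₑ = 1 := by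
        rw [← ofReal_norm, show -(2 * Real.pi * (inner ℝ k x : ℝ) * Complex.I : ℂ) =
          ((-(2 * Real.pi * inner ℝ k x) : ℝ) : ℂ) * Complex.I by push_cast; ring,
          Complex.norm_exp_ofReal_mul_I, ENNReal.ofReal_one]
      rw [e, one_mul, ← ofReal_norm, ← ofReal_norm, Complex.norm_real]
      exact ENNReal.ofReal_le_ofReal (PiLp.norm_apply_le (v x) i)
  calc ‖fourierCoeffBox L v k‖ₑ ≤ ∑ i, ‖fourierCoeffBox L v k i‖ₑ := by
        simp only [← ofReal_norm]
        rw [← ENNReal.ofReal_sum_of_nonneg fun _ _ => norm_nonneg _]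
        exact ENNReal.ofReal_le_ofReal (norm_le_sum_norm _)
    _ ≤ ∑ _i : Fin 3, ENNReal.ofReal (L ^ 3)⁻¹ * ∫⁻ x in box L, ‖v x‖ₑ :=
        Finset.sum_le_sum fun i _ => h1 i
    _ = _ := by
        rw [ENNReal.ofReal_mul (by norm_num)]
        simp [mul_assoc]

theorem exists_enorm_piece_le (hχ : IsCutoff χ) (hL : 0 < L) (q : ℕ) :
    ∃ B : ℝ≥0∞, B ≠ ⊤ ∧ ∀ (v : E3 → E3) (x : E3),
      ‖piece χ L v q x‖ₑ ≤ B * ∫⁻ y in box L, ‖v y‖ₑ := by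
  refine ⟨∑ m ∈ frequencies q, ‖(multiplier χ L q (latticePoint L m) : ℂ)‖ₑ *
    ENNReal.ofReal (3 * (L ^ 3)⁻¹), ?_, fun v x => ?_⟩
  · exact ENNReal.sum_ne_top.2 fun m _ => ENNReal.mul_ne_top enorm_ne_top ENNReal.ofReal_ne_top
  · rw [piece_eq_sum hχ hL, Finset.sum_mul]
    refine (enorm_sum_C3_le _ _).trans (Finset.sum_le_sum fun m _ => ?_)
    rw [enorm_smul, pieceCoeff, enorm_smul, ← ofReal_norm, norm_wave, ENNReal.ofReal_one, one_mul,
      mul_assoc]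
    gcongr
    exact enorm_fourierCoeffBox_le hL v _

/-- On each slice the piece is bounded by a multiple of the `L¹` norm of `u`, hence of its `L²`
norm. The constant may depend on `q`, since only finiteness matters. -/
theorem lintegral_piece_sq_ne_top (hχ : IsCutoff χ) (hL : 0 < L)
    (hu : MemLp (fun z : ℝ × E3 => u z.1 z.2) 2 (volume.restrict (spaceTime L T))) (q : ℕ) :
    ∫⁻ z in spaceTime L T, ‖piece χ L (u z.1) q z.2‖ₑ ^ 2 ≠ ⊤ := by
  obtain ⟨B, hB, h⟩ := exists_enorm_piece_le hχ hL q
  have hfin : ∫⁻ z in spaceTime L T, ‖u z.1 z.2‖ₑ ^ 2 ≠ ⊤ := by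
    have := hu.2
    rw [eLpNorm_lt_top_iff_lintegral_rpow_enorm_lt_top (by norm_num) (by norm_num)] at this
    simpa using this.ne
  have hm : AEMeasurable (fun z : ℝ × E3 => ‖u z.1 z.2‖ₑ ^ 2)
      ((volume.restrict (Icc 0 T)).prod (volume.restrict (box L))) := by
    rw [← volume_restrict_spaceTime]
    exact hu.1.enorm.pow_const 2
  have hsl : ∀ᵐ t ∂volume.restrict (Icc 0 T),
      AEMeasurable (fun x => ‖u t x‖ₑ) (volume.restrict (box L)) := by
    obtain ⟨G, hG, h⟩ := hu.1
    rw [volume_restrict_spaceTime] at h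
    filter_upwards [Measure.ae_ae_of_ae_prod h] with t ht
    have hGt : Measurable fun x => G (t, x) := hG.measurable.comp measurable_prodMk_left
    exact ⟨fun x => ‖G (t, x)‖ₑ, hGt.enorm, by
      filter_upwards [ht] with x hx
      rw [hx]⟩
  have hpm := (aemeasurable_piece hχ hL hu.1 q).enorm.pow_const 2
  rw [volume_restrict_spaceTime] at hfin hpm ⊢
  rw [lintegral_prod _ hpm]
  rw [lintegral_prod _ hm] at hfin
  have hcs : ∀ᵐ t ∂volume.restrict (Icc 0 T),
      ∫⁻ x in box L, ‖piece χ L (u t) q x‖ₑ ^ 2 ≤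
        (B ^ 2 * volume (box L) ^ 2) * ∫⁻ x in box L, ‖u t x‖ₑ ^ 2 := by
    filter_upwards [hsl] with t ht
    have h1 := lintegral_mul_pow_succ_le ht (measurable_const (a := (1 : ℝ≥0∞))) one_ne_zero
    simp only [mul_one, lintegral_const, one_mul, Measure.restrict_apply_univ, pow_one] at h1
    calc _ ≤ ∫⁻ _x in box L, (B * ∫⁻ y in box L, ‖u t y‖ₑ) ^ 2 :=
          lintegral_mono fun x => pow_le_pow_left₀ zero_le (h (u t) x) 2
      _ = B ^ 2 * volume (box L) * (∫⁻ y in box L, ‖u t y‖ₑ) ^ 2 := by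
          rw [lintegral_const, Measure.restrict_apply_univ, mul_pow]; ring
      _ ≤ B ^ 2 * volume (box L) * (volume (box L) * ∫⁻ x in box L, ‖u t x‖ₑ ^ 2) := by
          gcongr
      _ = _ := by ring
  refine ((lintegral_mono_ae hcs).trans_lt ?_).ne
  have hc : B ^ 2 * volume (box L) ^ 2 ≠ ⊤ := by
    rw [volume_box hL]
    exact ENNReal.mul_ne_top (ENNReal.pow_ne_top hB) (ENNReal.pow_ne_top ENNReal.ofReal_ne_top)
  rw [lintegral_const_mul' _ _ hc]
  exact ENNReal.mul_lt_top hc.lt_top hfin.lt_top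

theorem lintegral_piece_pow_eq (hL : 0 < L) (hT : 0 < T) (q p : ℕ) :
    ∫⁻ z in spaceTime L T, ‖piece χ L (u z.1) q z.2‖ₑ ^ p =
      meanPow χ L T u q p * ENNReal.ofReal (T * L ^ 3) := by
  rw [meanPow, setLAverage_eq, volume_spaceTime hL hT, ENNReal.div_mul_cancel]
  · simp; positivity
  · exact ENNReal.ofReal_ne_top

theorem meanPow_two_ne_top (hχ : IsCutoff χ) (hL : 0 < L) (hT : 0 < T)
    (hu : MemLp (fun z : ℝ × E3 => u z.1 z.2) 2 (volume.restrict (spaceTime L T))) (q : ℕ) :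
    meanPow χ L T u q 2 ≠ ⊤ := by
  rw [meanPow, setLAverage_eq]
  refine ENNReal.div_ne_top (lintegral_piece_sq_ne_top hχ hL hu q) ?_
  rw [volume_spaceTime hL hT]
  simp; positivity

theorem meanPow_three_eq_zero (hχ : IsCutoff χ) (hL : 0 < L) (hT : 0 < T)
    (hu : AEStronglyMeasurable (fun z : ℝ × E3 => u z.1 z.2)
      (volume.restrict (spaceTime L T))) {q : ℕ} (h : meanPow χ L T u q 2 = 0) :
    meanPow χ L T u q 3 = 0 := by
  have h2 := lintegral_piece_pow_eq (χ := χ) (u := u) hL hT q 2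
  rw [h, zero_mul, lintegral_eq_zero_iff' ((aemeasurable_piece hχ hL hu q).enorm.pow_const 2)] at h2
  have h3 : ∫⁻ z in spaceTime L T, ‖piece χ L (u z.1) q z.2‖ₑ ^ 3 = 0 := by
    rw [lintegral_eq_zero_iff' ((aemeasurable_piece hχ hL hu q).enorm.pow_const 3)]
    filter_upwards [h2] with z hz
    simpa using hz
  rw [meanPow, setLAverage_eq, h3, ENNReal.zero_div]

/-! ### The volume of the active regions -/

theorem dilatedCube_subset_box (hL : 0 < L) (q : ℕ) (k : Fin 3 → Fin (2 ^ q)) :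
    dilatedCube L q k ⊆ box L :=
  Set.iUnion₂_subset fun k' _ => cube_subset_box hL q k'

theorem activeRegion_subset_spaceTime (hL : 0 < L) (q : ℕ) :
    activeRegion χ η M L T u σ q ⊆ spaceTime L T := fun z hz => by
  obtain ⟨k, _, hk⟩ := Set.mem_iUnion₂.1 hz.2
  exact ⟨hz.1, dilatedCube_subset_box hL q k hk⟩

theorem measurable_smear {F : ℝ × E3 → C3} (hF : Measurable F) (r : ℝ) :
    Measurable fun z : ℝ × E3 => smear r (fun x => F (z.1, x)) z.2 := by
  have h : Measurable fun p : (ℝ × E3) × E3 => ‖F (p.1.1, p.1.2 - r⁻¹ • p.2)‖ₑ * weight p.2 := by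
    refine Measurable.mul (Measurable.enorm (hF.comp ?_)) (measurable_weight.comp measurable_snd)
    fun_prop
  exact h.lintegral_prod_right'

theorem lintegral_spaceTime_smear_pow_three_le (hL : 0 < L) (r : ℝ) {F : ℝ × E3 → C3}
    (hF : Measurable F) (hper : ∀ t x n, F (t, x + period L n) = F (t, x)) :
    ∫⁻ z in spaceTime L T, smear r (fun x => F (z.1, x)) z.2 ^ 3 ≤
      (∫⁻ z, weight z) ^ 3 * ∫⁻ z in spaceTime L T, ‖F z‖ₑ ^ 3 := by
  have h1 : Measurable fun z : ℝ × E3 => smear r (fun x => F (z.1, x)) z.2 ^ 3 :=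
    (measurable_smear hF r).pow_const 3
  have h2 : Measurable fun z : ℝ × E3 => ‖F z‖ₑ ^ 3 := hF.enorm.pow_const 3
  have h3 : ∀ t, Measurable fun x => F (t, x) := fun t => hF.comp measurable_prodMk_left
  rw [volume_restrict_spaceTime, lintegral_prod _ h1.aemeasurable,
    lintegral_prod _ h2.aemeasurable, ← lintegral_const_mul _ h2.lintegral_prod_right']
  refine lintegral_mono fun t => ?_
  have h4 := lintegral_smear_pow_three_le hL r (h3 t) (hper t)
  exact h4

/-- Up to a null set of times, the active region is contained in a measurable set of controlled
volume. -/
theorem exists_measurable_superset_activeSlice (hχ : IsCutoff χ) (hη : IsMollifier η) (M : ℕ) :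
    ∃ κ : ℝ, 0 ≤ κ ∧ ∀ (L T : ℝ), 0 < L → 0 < T → ∀ σ : ℕ → ℝ, (∀ q, 0 < σ q) →
      ∀ u : ℝ → E3 → E3,
        MemLp (fun z : ℝ × E3 => u z.1 z.2) 2 (volume.restrict (spaceTime L T)) →
      ∀ q, ∃ H : Set (ℝ × E3), MeasurableSet H ∧
        (∀ᵐ t ∂volume.restrict (Icc 0 T),
          activeSlice χ η M L T u σ q t ⊆ Prod.mk t ⁻¹' H) ∧
        volume H ≤
          ENNReal.ofReal (κ * (σ q)⁻¹ ^ 3) * activeVolume χ L T u q * ENNReal.ofReal T := by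
  obtain ⟨C, hC0, hC⟩ := exists_lt_smear_of_lt_atomicCoeff hχ hη M
  set W := (∫⁻ z, weight z).toReal
  have hW : ∫⁻ z, weight z = ENNReal.ofReal W :=
    (ENNReal.ofReal_toReal lintegral_weight_ne_top).symm
  have hW0 : 0 ≤ W := ENNReal.toReal_nonneg
  refine ⟨(C * W) ^ 3, by positivity, fun L T hL hT σ hσ u hu q => ?_⟩
  obtain ⟨g, hg, hug⟩ := exists_measurable_piece (χ := χ) hχ hL hu.1
  set r := waveNumber L q
  set θ := threshold χ L T u σ q with hθ
  set S : ℝ × E3 → ℝ≥0∞ := fun z => ENNReal.ofReal C * smear r (piece χ L (g z.1) q) z.2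
  have hS : Measurable S := (measurable_smear (hg q) r).const_mul _
  -- Built from the measurable representative, this superlevel set is measurable, whereas the active
  -- region itself need not be.
  set H : Set (ℝ × E3) := spaceTime L T ∩ {z | θ < S z}
  have hH : MeasurableSet H :=
    (measurableSet_spaceTime L T).inter (measurableSet_lt measurable_const hS)
  refine ⟨H, hH, ?_, ?_⟩
  · filter_upwards [hug, ae_restrict_mem measurableSet_Icc] with t ht htT x hx
    obtain ⟨k, hk, hxk⟩ := Set.mem_iUnion₂.1 hx
    refine ⟨⟨htT, dilatedCube_subset_box hL q k hxk⟩, ?_⟩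
    have := hC L hL (u t) q k θ x hxk hk
    rwa [ht q] at this
  have hsmear := lintegral_spaceTime_smear_pow_three_le (T := T)
    (F := fun z => piece χ L (g z.1) q z.2) hL r (hg q) fun t x n => piece_add_period hχ hL x n
  have hI : ∫⁻ z in spaceTime L T, S z ^ 3 ≤
      ENNReal.ofReal ((C * W) ^ 3) * (meanPow χ L T u q 3 * ENNReal.ofReal (T * L ^ 3)) := by
    have h1 : ∫⁻ z in spaceTime L T, ‖piece χ L (g z.1) q z.2‖ₑ ^ 3 =
        ∫⁻ z in spaceTime L T, ‖piece χ L (u z.1) q z.2‖ₑ ^ 3 := by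
      refine lintegral_congr_ae ?_
      rw [volume_restrict_spaceTime]
      filter_upwards [Measure.quasiMeasurePreserving_fst.ae hug] with z hz
      rw [hz q]
    rw [← lintegral_piece_pow_eq hL hT, ← h1]
    simp only [S, mul_pow]
    rw [lintegral_const_mul _ ((measurable_smear (hg q) r).pow_const 3),
      ENNReal.ofReal_mul (by positivity), mul_assoc, ENNReal.ofReal_pow hC0,
      ENNReal.ofReal_pow hW0, ← hW]
    gcongr
  have hX2 := meanPow_two_ne_top hχ hL hT hu q
  have hX0 := meanPow_three_eq_zero (q := q) hχ hL hT hu.1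
  -- Chebyshev's inequality for `S ^ 3`.
  have hmk : θ ^ 3 * volume H ≤
      ENNReal.ofReal ((C * W) ^ 3) * (meanPow χ L T u q 3 * ENNReal.ofReal (T * L ^ 3)) := by
    refine le_trans ?_ hI
    refine le_trans ?_ (mul_meas_ge_le_lintegral (hS.pow_const 3) (θ ^ 3))
    refine mul_le_mul_right ?_ _
    rw [Measure.restrict_apply (measurableSet_le measurable_const (hS.pow_const 3)), inter_comm]
    refine measure_mono (inter_subset_inter_right _ fun z hz => ?_)
    exact pow_le_pow_left₀ zero_le (le_of_lt (show θ < S z from hz)) 3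
  unfold threshold at hθ
  unfold activeVolume
  generalize meanPow χ L T u q 2 = X at *
  generalize meanPow χ L T u q 3 = Y at *
  -- For `Y = 0` the threshold vanishes and cannot be divided out, but `S` is then zero almost
  -- everywhere. For `Y = ∞` the threshold is infinite and `H` is empty.
  rcases eq_or_ne Y 0 with rfl | hY0
  · have h0 : ∫⁻ z in spaceTime L T, S z ^ 3 = 0 := by simpa using hI
    rw [lintegral_eq_zero_iff (hS.pow_const 3)] at h0
    have : volume H = 0 := by
      refine measure_mono_null (t := spaceTime L T ∩ {z | S z ≠ 0})
        (inter_subset_inter_right _ fun z hz => (zero_le.trans_lt hz).ne') ?_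
      have h1 : ∀ᵐ z ∂volume.restrict (spaceTime L T), ¬ S z ≠ 0 := by
        filter_upwards [h0] with z hz
        simpa using hz
      rw [ae_iff, Measure.restrict_apply' (measurableSet_spaceTime L T), inter_comm] at h1
      simpa using h1
    rw [this]
    exact zero_le
  rcases eq_or_ne Y ⊤ with rfl | hYt
  · have hθt : θ = ⊤ := by
      rw [hθ, ENNReal.top_div_of_ne_top hX2, ENNReal.mul_top]
      simpa using hσ q
    have : H = ∅ := by
      ext z
      simp [H, hθt]
    simp [this]
  have hX0' : X ≠ 0 := fun h => hY0 (hX0 h)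
  have hx : X = ENNReal.ofReal X.toReal := (ENNReal.ofReal_toReal hX2).symm
  have hy : Y = ENNReal.ofReal Y.toReal := (ENNReal.ofReal_toReal hYt).symm
  have hxp : 0 < X.toReal := ENNReal.toReal_pos hX0' hX2
  have hyp : 0 < Y.toReal := ENNReal.toReal_pos hY0 hYt
  generalize X.toReal = x at *
  generalize Y.toReal = y at *
  subst hx hy
  have hs := hσ q
  generalize σ q = s at *
  have hθ' : θ = ENNReal.ofReal (s * (y / x)) := by
    rw [hθ, ← ENNReal.ofReal_div_of_pos hxp, ← ENNReal.ofReal_mul hs.le]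
  have hθ0 : θ ^ 3 ≠ 0 := by
    rw [hθ']
    have : 0 < s * (y / x) := by positivity
    simpa using this
  have hθt : θ ^ 3 ≠ ⊤ := by rw [hθ']; exact ENNReal.pow_ne_top ENNReal.ofReal_ne_top
  -- Division by `θ³ = σ³ Y³ / X³` turns `Y T L³` into `σ⁻³ (L³ X³ / Y²) T`, which is `σ⁻³ V_q T`.
  rw [← ENNReal.mul_le_mul_iff_right hθ0 hθt]
  refine hmk.trans (le_of_eq ?_)
  rw [hθ', ← ENNReal.ofReal_pow hxp.le, ← ENNReal.ofReal_pow hyp.le,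
    ← ENNReal.ofReal_div_of_pos (by positivity), ← ENNReal.ofReal_mul (by positivity),
    ← ENNReal.ofReal_mul (by positivity), ← ENNReal.ofReal_pow (by positivity),
    ← ENNReal.ofReal_mul (by positivity), ← ENNReal.ofReal_mul (by positivity),
    ← ENNReal.ofReal_mul (by positivity), ← ENNReal.ofReal_mul (by positivity)]
  congr 1
  field_simp

/-- The exceptional times are null, so their product with space is null. Monotonicity of the outer
measure needs no measurability of the active region. -/
theorem volume_activeRegion_le {H : Set (ℝ × E3)} {q : ℕ}
    (hH : ∀ᵐ t ∂volume.restrict (Icc 0 T), activeSlice χ η M L T u σ q t ⊆ Prod.mk t ⁻¹' H) :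
    volume (activeRegion χ η M L T u σ q) ≤ volume H := by
  rw [ae_restrict_iff' measurableSet_Icc] at hH
  set N := {t | ¬ (t ∈ Icc 0 T → activeSlice χ η M L T u σ q t ⊆ Prod.mk t ⁻¹' H)}
  have hN : volume (N ×ˢ (univ : Set E3)) = 0 := by
    rw [Measure.volume_eq_prod, Measure.prod_prod, ae_iff.1 hH, zero_mul]
  calc volume (activeRegion χ η M L T u σ q) ≤ volume (H ∪ N ×ˢ univ) := by
        refine measure_mono fun z hz => ?_
        by_cases h : z.1 ∈ N
        · exact Or.inr ⟨h, mem_univ _⟩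
        · exact Or.inl (not_not.1 h hz.1 hz.2)
    _ ≤ volume H + volume (N ×ˢ (univ : Set E3)) := measure_union_le _ _
    _ = volume H := by rw [hN, add_zero]

/-! ### The mass of the active regions -/

theorem lintegral_le_add_lintegral_activeRegion (hχ : IsCutoff χ) (hη : IsMollifier η)
    (hL : 0 < L) (hT : 0 < T)
    (hu : MemLp (fun z : ℝ × E3 => u z.1 z.2) 2 (volume.restrict (spaceTime L T))) (q : ℕ) :
    ∫⁻ z in spaceTime L T, ‖piece χ L (u z.1) q z.2‖ₑ ^ 3 ≤
      ENNReal.ofReal (27 * σ q) * (∫⁻ z in spaceTime L T, ‖piece χ L (u z.1) q z.2‖ₑ ^ 3) +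
      ∫⁻ z in activeRegion χ η M L T u σ q, ‖piece χ L (u z.1) q z.2‖ₑ ^ 3 := by
  set A := activeRegion χ η M L T u σ q
  set θ := threshold χ L T u σ q with hθ
  have hm := aemeasurable_piece hχ hL hu.1 q
  have hmA := hm.mono_set (sdiff_subset : spaceTime L T \ A ⊆ spaceTime L T)
  have hsmall : ∀ᵐ z ∂volume.restrict (spaceTime L T \ A), ‖piece χ L (u z.1) q z.2‖ₑ ≤ 27 * θ := by
    -- The domain of integration may fail to be measurable; null-measurability of the condition
    -- suffices instead.
    rw [ae_restrict_iff₀ (nullMeasurableSet_le hmA.enorm aemeasurable_const)]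
    refine Eventually.of_forall fun z hz => ?_
    refine enorm_piece_le_of_forall_notMem hη hL hz.1.2 (M := M) fun k hk hzk => hz.2 ?_
    exact ⟨hz.1.1, Set.mem_iUnion₂.2 ⟨k, hk, hzk⟩⟩
  have hrest : ∫⁻ z in spaceTime L T \ A, ‖piece χ L (u z.1) q z.2‖ₑ ^ 3 ≤
      ENNReal.ofReal (27 * σ q) * ∫⁻ z in spaceTime L T, ‖piece χ L (u z.1) q z.2‖ₑ ^ 3 := by
    calc _ ≤ ∫⁻ z in spaceTime L T \ A, 27 * θ * ‖piece χ L (u z.1) q z.2‖ₑ ^ 2 := by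
          refine lintegral_mono_ae ?_
          filter_upwards [hsmall] with z hz
          rw [pow_succ, mul_comm]
          gcongr
      _ ≤ ∫⁻ z in spaceTime L T, 27 * θ * ‖piece χ L (u z.1) q z.2‖ₑ ^ 2 :=
          lintegral_mono_set sdiff_subset
      _ = 27 * θ * (meanPow χ L T u q 2 * ENNReal.ofReal (T * L ^ 3)) := by
          rw [lintegral_const_mul'' _ (hm.enorm.pow_const 2), lintegral_piece_pow_eq hL hT]
      _ ≤ _ := by
          have h27 : (27 : ℝ≥0∞) = ENNReal.ofReal 27 := by simp
          rw [lintegral_piece_pow_eq hL hT, hθ, threshold,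
            ENNReal.ofReal_mul (p := 27) (q := σ q) (by norm_num), ← h27]
          calc _ = 27 * ENNReal.ofReal (σ q) * (meanPow χ L T u q 3 / meanPow χ L T u q 2 *
                meanPow χ L T u q 2 * ENNReal.ofReal (T * L ^ 3)) := by ring
            _ ≤ _ := by
              gcongr
              -- In `[0,∞]` the bound `(Y / X) X ≤ Y` holds without excluding the degenerate values.
              exact (mul_comm _ _).trans_le ENNReal.mul_div_le
  calc ∫⁻ z in spaceTime L T, ‖piece χ L (u z.1) q z.2‖ₑ ^ 3
      ≤ ∫⁻ z in (spaceTime L T \ A) ∪ A, ‖piece χ L (u z.1) q z.2‖ₑ ^ 3 :=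
        lintegral_mono_set (by rw [sdiff_union_self]; exact subset_union_left)
    _ ≤ _ := (lintegral_union_le _ _ _).trans (by gcongr)

end SpaceTime

end Intermittency

namespace Intermittency

section Dimension

variable {χ η : E3 → ℝ} {L T : ℝ} {u : ℝ → E3 → E3} {σ : ℕ → ℝ} {M : ℕ}

/-! ### Decay of the active volumes -/

/-- The hypothesis says `𝔥 > 3 - s`, and a number strictly below a liminf is eventually exceeded:
`log₂ (L³ / V_q) > (3 - s) q`. -/
theorem eventually_activeVolume_le (hL : 0 < L) {s : ℝ} (hs : dimension χ L T u < s) :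
    ∀ᶠ q : ℕ in atTop,
      activeVolume χ L T u q ≤ ENNReal.ofReal (L ^ 3 * 2 ^ ((s - 3) * (q : ℝ))) := by
  have h1 : ((3 - s : ℝ) : EReal) < codimension χ L T u := by
    unfold dimension at hs
    generalize codimension χ L T u = z at *
    induction z with
    | bot =>
      rw [sub_eq_add_neg, EReal.neg_bot, EReal.add_top_of_ne_bot (by decide)] at hs
      exact absurd hs (not_lt.2 le_top)
    | top => exact EReal.coe_lt_top _
    | coe h =>
      have h3 : (3 : EReal) = ((3 : ℝ) : EReal) := rfl
      rw [h3, ← EReal.coe_sub, EReal.coe_lt_coe_iff] at hs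
      rw [EReal.coe_lt_coe_iff]
      linarith
  filter_upwards [eventually_lt_of_lt_liminf h1, eventually_gt_atTop 0] with q hq hq0
  have hqp : (0 : ℝ) < q := by exact_mod_cast hq0
  have hl2 : (0 : ℝ) < Real.log 2 := Real.log_pos (by norm_num)
  rw [EReal.lt_div_iff (by exact_mod_cast hqp) (EReal.coe_ne_top _),
    EReal.lt_div_iff (by exact_mod_cast hl2) (EReal.coe_ne_top _),
    ← EReal.coe_mul, ← EReal.coe_mul] at hq
  set E : ℝ := Real.exp ((3 - s) * q * Real.log 2) with hE
  have hE0 : 0 < E := Real.exp_pos _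
  have h2 : ENNReal.ofReal E ≤ ENNReal.ofReal (L ^ 3) / activeVolume χ L T u q := by
    by_contra hcon
    rw [not_le] at hcon
    have := ENNReal.log_monotone hcon.le
    rw [ENNReal.log_ofReal_of_pos hE0, hE, Real.log_exp] at this
    exact absurd hq (not_lt.2 this)
  have hL3 : 0 < L ^ 3 := by positivity
  rw [ENNReal.le_div_iff_mul_le (Or.inr (by simpa using hL3)) (Or.inr ENNReal.ofReal_ne_top),
    mul_comm, ← ENNReal.le_div_iff_mul_le (Or.inl (by simpa using hE0))
    (Or.inl ENNReal.ofReal_ne_top), ← ENNReal.ofReal_div_of_pos hE0] at h2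
  refine h2.trans (le_of_eq ?_)
  congr 1
  rw [hE, Real.rpow_def_of_pos (by norm_num), div_eq_mul_inv, ← Real.exp_neg]
  ring_nf

theorem eventually_inv_pow_three_le (hσ : ∀ q, 0 < σ q)
    (h : Tendsto (fun q : ℕ => Real.log (σ q) / (q : ℝ)) atTop (𝓝 0)) {ε : ℝ} (hε : 0 < ε) :
    ∀ᶠ q : ℕ in atTop, (σ q)⁻¹ ^ 3 ≤ 2 ^ (ε * (q : ℝ)) := by
  have hl2 : (0 : ℝ) < Real.log 2 := Real.log_pos (by norm_num)
  -- The third of `ε` compensates for the cube of `σ_q⁻¹`.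
  have hlt : -(ε / 3 * Real.log 2) < 0 := by
    have : 0 < ε / 3 * Real.log 2 := by positivity
    linarith
  filter_upwards [h.eventually (lt_mem_nhds hlt), eventually_gt_atTop 0] with q hq hq0
  have hqp : (0 : ℝ) < q := by exact_mod_cast hq0
  rw [lt_div_iff₀ hqp] at hq
  have h1 : (σ q)⁻¹ ^ 3 = Real.exp (-(3 * Real.log (σ q))) := by
    rw [Real.exp_neg, show 3 * Real.log (σ q) = ((3 : ℕ) : ℝ) * Real.log (σ q) by norm_num,
      Real.exp_nat_mul, Real.exp_log (hσ q), inv_pow]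
  rw [h1, Real.rpow_def_of_pos (by norm_num)]
  apply Real.exp_le_exp.2
  linarith

/-! ### Counting the cubes of an active region -/

/-- The indices of the cubes that make up the active region at time `t`. -/
noncomputable def activeIndices (χ η : E3 → ℝ) (M : ℕ) (L T : ℝ) (u : ℝ → E3 → E3) (σ : ℕ → ℝ)
    (q : ℕ) (t : ℝ) : Finset (Fin 3 → Fin (2 ^ q)) :=
  open scoped Classical in
  Finset.univ.filter fun k' =>
    ∃ k, threshold χ L T u σ q < atomicCoeff χ η M L (u t) q k ∧ Near q k' k

theorem activeSlice_eq (q : ℕ) (t : ℝ) :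
    activeSlice χ η M L T u σ q t = ⋃ k ∈ activeIndices χ η M L T u σ q t, cube L q k := by
  ext x
  simp only [activeSlice, dilatedCube, activeIndices, Set.mem_iUnion, Finset.mem_filter,
    Finset.mem_univ, true_and, exists_prop]
  constructor
  · rintro ⟨k, hk, k', hk', hx⟩
    exact ⟨k', ⟨k, hk, hk'⟩, hx⟩
  · rintro ⟨k', ⟨k, hk, hk'⟩, hx⟩
    exact ⟨k, hk, k', hk', hx⟩

theorem card_activeIndices_mul (hL : 0 < L) (q : ℕ) (t : ℝ) :
    ((activeIndices χ η M L T u σ q t).card : ℝ≥0∞) * ENNReal.ofReal (lengthScale L q) ^ 3 =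
      volume (activeSlice χ η M L T u σ q t) := by
  rw [activeSlice_eq, measure_biUnion_finset
    (fun i _ j _ hij => pairwise_disjoint_cube hL q hij) fun k _ => measurableSet_cube L q k]
  simp [volume_cube]

/-- For exponents above the dimension, the weighted numbers of cubes are summable. -/
theorem ae_tsum_card_activeIndices_ne_top (hχ : IsCutoff χ) (hη : IsMollifier η) (hL : 0 < L)
    (hT : 0 < T) (hσ : ∀ q, 0 < σ q)
    (hσ' : Tendsto (fun q : ℕ => Real.log (σ q) / (q : ℝ)) atTop (𝓝 0))
    (hu : MemLp (fun z : ℝ × E3 => u z.1 z.2) 2 (volume.restrict (spaceTime L T)))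
    {s' s : ℝ} (hs' : dimension χ L T u < s') (hs : s' < s) :
    ∃ q₀ : ℕ, ∀ᵐ t ∂volume.restrict (Icc 0 T),
      ∑' j : ℕ, ((activeIndices χ η M L T u σ (q₀ + j) t).card : ℝ≥0∞) *
        ENNReal.ofReal (2 ^ (-s * ((q₀ + j : ℕ) : ℝ))) ≠ ⊤ := by
  -- Half of the gap absorbs `σ_q⁻³`; the other half remains as the geometric rate `2^(-ε)`.
  set ε := (s - s') / 2 with hε
  have hε0 : 0 < ε := by rw [hε]; linarith
  obtain ⟨κ, hκ0, hκ⟩ := exists_measurable_superset_activeSlice hχ hη M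
  choose H hH hHs hHv using hκ L T hL hT σ hσ u hu
  obtain ⟨q₀, hq₀⟩ := eventually_atTop.1
    ((eventually_activeVolume_le hL hs').and (eventually_inv_pow_three_le hσ hσ' hε0))
  refine ⟨q₀, ?_⟩
  -- The factor that converts the volume of a union of cubes into their number weighted by
  -- `2^(-sq)`.
  set D : ℕ → ℝ≥0∞ := fun q =>
    ENNReal.ofReal (2 ^ (-s * (q : ℝ)) * (lengthScale L q ^ 3)⁻¹) with hD
  have hmB : ∀ q, Measurable fun t => volume (Prod.mk t ⁻¹' H q) := fun q =>
    measurable_measure_prodMk_left (hH q)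
  have hint : ∀ j, ∫⁻ t in Icc 0 T, volume (Prod.mk t ⁻¹' H (q₀ + j)) * D (q₀ + j) ≤
      ENNReal.ofReal (κ * T * (2 ^ (-ε)) ^ (q₀ + j)) := by
    intro j
    obtain ⟨hV, hS⟩ := hq₀ (q₀ + j) (Nat.le_add_right _ _)
    generalize q₀ + j = q at *
    have hsq := hσ q
    rw [lintegral_mul_const _ (hmB q)]
    calc _ ≤ volume (H q) * D q := by
          gcongr
          rw [Measure.volume_eq_prod, Measure.prod_apply (hH q)]
          exact setLIntegral_le_lintegral _ _
      _ ≤ ENNReal.ofReal (κ * 2 ^ (ε * (q : ℝ))) *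
            ENNReal.ofReal (L ^ 3 * 2 ^ ((s' - 3) * (q : ℝ))) * ENNReal.ofReal T * D q := by
          gcongr
          refine (hHv q).trans ?_
          gcongr
      _ = _ := by
          rw [hD, ← ENNReal.ofReal_mul (by positivity), ← ENNReal.ofReal_mul (by positivity),
            ← ENNReal.ofReal_mul (by positivity)]
          congr 1
          have e1 : (lengthScale L q ^ 3)⁻¹ = (L ^ 3)⁻¹ * 2 ^ (3 * (q : ℝ)) := by
            rw [lengthScale, div_pow, inv_div, div_eq_inv_mul, mul_comm (3 : ℝ),
              Real.rpow_mul (by norm_num)]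
            norm_cast
          have e2 : ((2 : ℝ) ^ (-ε)) ^ q = 2 ^ (ε * (q : ℝ)) * 2 ^ ((s' - 3) * (q : ℝ)) *
              2 ^ (-s * (q : ℝ)) * 2 ^ (3 * (q : ℝ)) := by
            rw [← Real.rpow_natCast, ← Real.rpow_mul (by norm_num),
              ← Real.rpow_add (by norm_num), ← Real.rpow_add (by norm_num),
              ← Real.rpow_add (by norm_num)]
            congr 1
            rw [hε]; ring
          rw [e1, e2]
          field_simp
  have hsum : ∫⁻ t in Icc 0 T, ∑' j, volume (Prod.mk t ⁻¹' H (q₀ + j)) * D (q₀ + j) ≠ ⊤ := by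
    rw [lintegral_tsum fun j => ((hmB _).mul_const _).aemeasurable]
    refine ((ENNReal.tsum_le_tsum hint).trans_lt ?_).ne
    refine Summable.tsum_ofReal_lt_top ?_
    have hlt : (2 : ℝ) ^ (-ε) < 1 :=
      Real.rpow_lt_one_of_one_lt_of_neg (by norm_num) (by linarith)
    have := (summable_geometric_of_lt_one (by positivity) hlt).mul_left (κ * T * (2 ^ (-ε)) ^ q₀)
    refine this.congr fun j => ?_
    rw [pow_add]; ring
  have hae := ae_lt_top (Measurable.tsum fun j => (hmB (q₀ + j)).mul_const _) hsum
  filter_upwards [hae, ae_all_iff.2 hHs] with t ht hts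
  refine ((ENNReal.tsum_le_tsum fun j => ?_).trans_lt ht).ne
  generalize q₀ + j = q
  have hl := lengthScale_pos hL q
  have h1 : ((activeIndices χ η M L T u σ q t).card : ℝ≥0∞) *
      ENNReal.ofReal (lengthScale L q) ^ 3 ≤ volume (Prod.mk t ⁻¹' H q) := by
    rw [card_activeIndices_mul hL]
    exact measure_mono (hts q)
  calc _ = ((activeIndices χ η M L T u σ q t).card : ℝ≥0∞) *
        ENNReal.ofReal (lengthScale L q) ^ 3 * D q := by
        rw [hD, mul_assoc, ← ENNReal.ofReal_pow hl.le, ← ENNReal.ofReal_mul (by positivity)]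
        congr 2
        field_simp
    _ ≤ _ := by gcongr

/-! ### Hausdorff dimension of the accumulant -/

theorem ediam_cube_le (hL : 0 < L) (q : ℕ) (k : Fin 3 → Fin (2 ^ q)) :
    Metric.ediam (cube L q k) ≤ ENNReal.ofReal (2 * lengthScale L q) := by
  have hl := lengthScale_pos hL q
  refine Metric.ediam_le fun x hx y hy => ?_
  rw [edist_dist]
  apply ENNReal.ofReal_le_ofReal
  rw [EuclideanSpace.dist_eq]
  refine Real.sqrt_le_iff.2 ⟨by positivity, ?_⟩
  have h : ∀ i, dist (x i) (y i) ≤ lengthScale L q := fun i => by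
    rw [Real.dist_eq, abs_le]
    constructor <;> nlinarith [(hx i).1, (hx i).2, (hy i).1, (hy i).2]
  calc _ ≤ ∑ _i : Fin 3, lengthScale L q ^ 2 := by
        gcongr with i
        exact h i
    _ ≤ _ := by simp; nlinarith

theorem timeSlice_accumulant_subset (t : ℝ) (p : ℕ) :
    timeSlice (accumulant χ η M L T u σ) t ⊆
      ⋃ j : ℕ, activeSlice χ η M L T u σ (p + j) t := by
  intro x hx
  have h1 := Set.mem_iInter₂.1 hx (max 1 p) (le_max_left _ _)
  obtain ⟨q, hq, hxq⟩ := Set.mem_iUnion₂.1 h1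
  obtain ⟨j, rfl⟩ := Nat.exists_eq_add_of_le ((le_max_right 1 p).trans hq.le)
  exact Set.mem_iUnion.2 ⟨j, hxq.2⟩

/-- The active cubes of all generations from `q₀ + p` on cover `A(t)`, and the sum of their
diameters to the power `s` is at most `(2L)^s` times a tail of the convergent series. -/
theorem hausdorffMeasure_accumulant_eq_zero (hL : 0 < L) {s : ℝ} (hs : 0 < s) {q₀ : ℕ} {t : ℝ}
    (h : ∑' j : ℕ, ((activeIndices χ η M L T u σ (q₀ + j) t).card : ℝ≥0∞) *
        ENNReal.ofReal (2 ^ (-s * ((q₀ + j : ℕ) : ℝ))) ≠ ⊤) :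
    Measure.hausdorffMeasure s (timeSlice (accumulant χ η M L T u σ) t) = 0 := by
  classical
  set J := fun q => activeIndices χ η M L T u σ q t
  set f : ℕ → ℝ≥0∞ := fun j => ((J (q₀ + j)).card : ℝ≥0∞) *
    ENNReal.ofReal (2 ^ (-s * ((q₀ + j : ℕ) : ℝ)))
  have hl := fun q => lengthScale_pos hL q
  have hanti : ∀ {p q : ℕ}, p ≤ q → lengthScale L q ≤ lengthScale L p := fun hpq => by
    unfold lengthScale
    gcongr
    norm_num
  have hr : Tendsto (fun p => ENNReal.ofReal (2 * lengthScale L (q₀ + p))) atTop (𝓝 0) := by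
    have h1 : Tendsto (fun p : ℕ => lengthScale L p) atTop (𝓝 0) :=
      tendsto_const_nhds.div_atTop (tendsto_pow_atTop_atTop_of_one_lt (by norm_num))
    have h2 := ((h1.comp (tendsto_add_atTop_nat q₀)).const_mul 2)
    rw [mul_zero] at h2
    have h3 := ENNReal.tendsto_ofReal h2
    rw [ENNReal.ofReal_zero] at h3
    exact h3.congr fun p => by simp [add_comm]
  have key := Measure.hausdorffMeasure_le_liminf_tsum (β := ℕ)
    (ι := fun p => Σ j : ℕ, (Fin 3 → Fin (2 ^ (q₀ + (j + p))))) s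
    (timeSlice (accumulant χ η M L T u σ) t) (l := atTop) _ hr
    -- Other indices contribute the empty set, which costs nothing since `0 ^ s = 0` for `s > 0`.
    (fun p i => if i.2 ∈ J (q₀ + (i.1 + p)) then cube L _ i.2 else ∅)
    (Eventually.of_forall fun p i => by
      split_ifs
      · refine (ediam_cube_le hL _ _).trans (ENNReal.ofReal_le_ofReal ?_)
        gcongr
        exact hanti (by omega)
      · simp)
    (Eventually.of_forall fun p x hx => by
      obtain ⟨j, hj⟩ := Set.mem_iUnion.1 (timeSlice_accumulant_subset t (q₀ + p) hx)
      rw [activeSlice_eq, show q₀ + p + j = q₀ + (j + p) by ring] at hj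
      obtain ⟨k, hk, hxk⟩ := Set.mem_iUnion₂.1 hj
      refine Set.mem_iUnion.2 ⟨⟨j, k⟩, ?_⟩
      simp only [J]
      rw [if_pos hk]
      exact hxk)
  have hcube : ∀ q, ∑' k : Fin 3 → Fin (2 ^ q),
      Metric.ediam (if k ∈ J q then cube L q k else ∅) ^ s ≤
      ENNReal.ofReal ((2 * L) ^ s) *
        (((J q).card : ℝ≥0∞) * ENNReal.ofReal (2 ^ (-s * (q : ℝ)))) := by
    intro q
    calc _ ≤ ∑' k : Fin 3 → Fin (2 ^ q), if k ∈ J q then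
          ENNReal.ofReal ((2 * L) ^ s) * ENNReal.ofReal (2 ^ (-s * (q : ℝ))) else 0 := by
          refine ENNReal.tsum_le_tsum fun k => ?_
          split_ifs
          · rw [← ENNReal.ofReal_mul (by positivity)]
            refine (ENNReal.rpow_le_rpow (ediam_cube_le hL q k) hs.le).trans (le_of_eq ?_)
            have := hl q
            rw [ENNReal.ofReal_rpow_of_nonneg (by positivity) hs.le]
            congr 1
            have e : 2 * lengthScale L q = 2 * L * 2 ^ (-(q : ℝ)) := by
              rw [lengthScale, Real.rpow_neg (by norm_num), Real.rpow_natCast]; ring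
            rw [e, Real.mul_rpow (by positivity) (by positivity), ← Real.rpow_mul (by norm_num)]
            congr 2
            ring
          · simp [hs]
      _ = _ := by
          rw [tsum_fintype, Finset.sum_ite_mem, Finset.univ_inter, Finset.sum_const, nsmul_eq_mul]
          ring
  have hbound : ∀ p, ∑' i : (Σ j : ℕ, (Fin 3 → Fin (2 ^ (q₀ + (j + p))))),
      Metric.ediam (if i.2 ∈ J (q₀ + (i.1 + p)) then cube L _ i.2 else ∅) ^ s ≤
      ENNReal.ofReal ((2 * L) ^ s) * ∑' j, f (j + p) := by
    intro p
    rw [ENNReal.tsum_sigma', ← ENNReal.tsum_mul_left]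
    exact ENNReal.tsum_le_tsum fun j => hcube _
  have hlim : Tendsto (fun p => ENNReal.ofReal ((2 * L) ^ s) * ∑' j, f (j + p)) atTop (𝓝 0) := by
    have := ENNReal.Tendsto.const_mul (ENNReal.tendsto_sum_nat_add f h)
      (Or.inr (ENNReal.ofReal_ne_top (r := (2 * L) ^ s)))
    rwa [mul_zero] at this
  refine le_antisymm (key.trans ?_) zero_le
  rw [← hlim.liminf_eq]
  exact liminf_le_liminf (Eventually.of_forall hbound)

/-- With exponent `0` the series is one of natural numbers. Its terms tend to zero, hence vanish
eventually. -/
theorem timeSlice_accumulant_eq_empty {q₀ : ℕ} {t : ℝ}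
    (h : ∑' j : ℕ, ((activeIndices χ η M L T u σ (q₀ + j) t).card : ℝ≥0∞) *
        ENNReal.ofReal (2 ^ (-0 * ((q₀ + j : ℕ) : ℝ))) ≠ ⊤) :
    timeSlice (accumulant χ η M L T u σ) t = ∅ := by
  simp only [neg_zero, zero_mul, Real.rpow_zero, ENNReal.ofReal_one, mul_one] at h
  obtain ⟨j₀, hj₀⟩ := eventually_atTop.1
    ((ENNReal.tendsto_atTop_zero_of_tsum_ne_top h).eventually (gt_mem_nhds one_pos))
  refine Set.eq_empty_iff_forall_notMem.2 fun x hx => ?_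
  obtain ⟨j, hj⟩ := Set.mem_iUnion.1 (timeSlice_accumulant_subset t (q₀ + j₀) hx)
  have h1 := hj₀ (j₀ + j) (Nat.le_add_right _ _)
  rw [← add_assoc] at h1
  have h2 : (activeIndices χ η M L T u σ (q₀ + j₀ + j) t).card < 1 := by exact_mod_cast h1
  rw [Nat.lt_one_iff, Finset.card_eq_zero] at h2
  rw [activeSlice_eq, h2] at hj
  simp at hj

theorem ae_dimH_accumulant_le (hχ : IsCutoff χ) (hη : IsMollifier η) (hL : 0 < L)
    (hT : 0 < T) (hσ : ∀ q, 0 < σ q)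
    (hσ' : Tendsto (fun q : ℕ => Real.log (σ q) / (q : ℝ)) atTop (𝓝 0))
    (hu : MemLp (fun z : ℝ × E3 => u z.1 z.2) 2 (volume.restrict (spaceTime L T)))
    (hd : 0 ≤ dimension χ L T u) :
    ∀ᵐ t ∂volume.restrict (Icc 0 T),
      ((dimH (timeSlice (accumulant χ η M L T u σ) t) : ℝ≥0∞) : EReal) ≤ dimension χ L T u := by
  induction hdim : dimension χ L T u with
  | bot => simp [hdim] at hd
  | top => simp
  | coe d =>
    rw [hdim] at hd
    have hd0 : 0 ≤ d := by exact_mod_cast hd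
    -- Countably many exponents decreasing to `d` suffice, so the exceptional null sets of times can
    -- be united.
    have hn : ∀ n : ℕ, ∀ᵐ t ∂volume.restrict (Icc 0 T),
        dimH (timeSlice (accumulant χ η M L T u σ) t) ≤
          ENNReal.ofReal (d + 1 / ((n : ℝ) + 1)) := by
      intro n
      have hp : (0 : ℝ) < 1 / ((n : ℝ) + 1) := by positivity
      obtain ⟨q₀, hq₀⟩ := ae_tsum_card_activeIndices_ne_top (M := M) hχ hη hL hT hσ hσ' hu
        (s' := d + 1 / ((n : ℝ) + 1) / 2) (s := d + 1 / ((n : ℝ) + 1))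
        (by rw [hdim, EReal.coe_lt_coe_iff]; linarith) (by linarith)
      filter_upwards [hq₀] with t ht
      have h0 := hausdorffMeasure_accumulant_eq_zero hL (by linarith) ht
      refine dimH_le_of_hausdorffMeasure_ne_top (d := (d + 1 / ((n : ℝ) + 1)).toNNReal) ?_
      rw [Real.coe_toNNReal _ (by linarith), h0]
      exact ENNReal.zero_ne_top
    filter_upwards [ae_all_iff.2 hn] with t ht
    have hlim : Tendsto (fun n : ℕ => ENNReal.ofReal (d + 1 / ((n : ℝ) + 1))) atTop
        (𝓝 (ENNReal.ofReal (d + 0))) :=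
      ENNReal.tendsto_ofReal (tendsto_const_nhds.add tendsto_one_div_add_atTop_nhds_zero_nat)
    have h1 := ge_of_tendsto' hlim ht
    rw [add_zero] at h1
    calc _ ≤ ((ENNReal.ofReal d : ℝ≥0∞) : EReal) := by exact_mod_cast h1
      _ = _ := by rw [EReal.coe_ennreal_ofReal, max_eq_left hd0]

theorem ae_timeSlice_accumulant_eq_empty (hχ : IsCutoff χ) (hη : IsMollifier η) (hL : 0 < L)
    (hT : 0 < T) (hσ : ∀ q, 0 < σ q)
    (hσ' : Tendsto (fun q : ℕ => Real.log (σ q) / (q : ℝ)) atTop (𝓝 0))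
    (hu : MemLp (fun z : ℝ × E3 => u z.1 z.2) 2 (volume.restrict (spaceTime L T)))
    (hd : dimension χ L T u < 0) :
    ∀ᵐ t ∂volume.restrict (Icc 0 T), timeSlice (accumulant χ η M L T u σ) t = ∅ := by
  obtain ⟨s, hs, hs0⟩ := EReal.lt_iff_exists_real_btwn.1 hd
  obtain ⟨q₀, hq₀⟩ := ae_tsum_card_activeIndices_ne_top (M := M) hχ hη hL hT hσ hσ' hu hs
    (s := 0) (by exact_mod_cast hs0)
  filter_upwards [hq₀] with t ht
  exact timeSlice_accumulant_eq_empty ht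

end Dimension

end Intermittency

theorem theoremt (χ η : E3 → ℝ) (hχ : IsCutoff χ) (hη : IsMollifier η) (M : ℕ) (hM : 1 < M) :
    ∃ c : ℝ, 0 < c ∧
      ∀ (L T : ℝ), 0 < L → 0 < T →
      ∀ σ : ℕ → ℝ, (∀ q, 0 < σ q) → Antitone σ → Tendsto σ atTop (𝓝 0) →
        Tendsto (fun q : ℕ => Real.log (σ q) / (q : ℝ)) atTop (𝓝 0) →
      ∀ u : ℝ → E3 → E3,
        MemLp (fun z : ℝ × E3 => u z.1 z.2) 2 (volume.restrict (spaceTime L T)) →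
        (∀ q : ℕ, volume (activeRegion χ η M L T u σ q) ≤
            ENNReal.ofReal (c * (σ q)⁻¹ ^ 3) * activeVolume χ L T u q * ENNReal.ofReal T) ∧
        (∀ q : ℕ, (∫⁻ z in spaceTime L T, ‖piece χ L (u z.1) q z.2‖ₑ ^ 3) ≠ ⊤ →
          ENNReal.ofReal (1 - c * σ q) * (∫⁻ z in spaceTime L T, ‖piece χ L (u z.1) q z.2‖ₑ ^ 3) ≤
            (∫⁻ z in activeRegion χ η M L T u σ q, ‖piece χ L (u z.1) q z.2‖ₑ ^ 3) ∧
          (∫⁻ z in activeRegion χ η M L T u σ q, ‖piece χ L (u z.1) q z.2‖ₑ ^ 3) ≤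
            (∫⁻ z in spaceTime L T, ‖piece χ L (u z.1) q z.2‖ₑ ^ 3)) ∧
        (0 ≤ dimension χ L T u →
          ∀ᵐ t ∂(volume.restrict (Icc 0 T)),
            ((dimH (timeSlice (accumulant χ η M L T u σ) t) : ℝ≥0∞) : EReal) ≤
              dimension χ L T u) ∧
        (dimension χ L T u < 0 →
          ∀ᵐ t ∂(volume.restrict (Icc 0 T)),
            timeSlice (accumulant χ η M L T u σ) t = ∅) := by
  obtain ⟨κ, hκ0, hκ⟩ := exists_measurable_superset_activeSlice hχ hη M
  -- Here `κ` serves the volume bound and `27` the mass bound.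
  refine ⟨κ + 27, by linarith, fun L T hL hT σ hσ _ _ hσ' u hu => ⟨fun q => ?_, fun q hfin => ?_,
    fun hd => ae_dimH_accumulant_le hχ hη hL hT hσ hσ' hu hd,
    fun hd => ae_timeSlice_accumulant_eq_empty hχ hη hL hT hσ hσ' hu hd⟩⟩
  · obtain ⟨H, _, hHs, hHv⟩ := hκ L T hL hT σ hσ u hu q
    refine (volume_activeRegion_le hHs).trans (hHv.trans ?_)
    have := hσ q
    gcongr
    linarith
  · refine ⟨?_, lintegral_mono_set (activeRegion_subset_spaceTime hL q)⟩
    have hsub := lintegral_le_add_lintegral_activeRegion (M := M) (σ := σ) hχ hη hL hT hu q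
    have hs := hσ q
    rw [ENNReal.ofReal_sub _ (by positivity), ENNReal.ofReal_one,
      ENNReal.sub_mul fun _ _ => hfin, one_mul, tsub_le_iff_left]
    refine hsub.trans ?_
    gcongr
    linarith
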